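/- Conventions. Hypergraphs on $[n]=\{1,\dots,n\}$ may have parallel hyperedges, and all counts below are with multiplicity. A matching is a hypergraph whose hyperedges are pairwise disjoint. For a hypergraph $\mathcal H$ let $d_{Q}$ be the number of hyperedges containing $Q\subseteq[n]$, and let $d_r=\max_{|Q|=r}d_{Q}$. For $t\in\{1,\dots,q\}$, a $q$-uniform hypergraph $\mathcal H$ on $[n]$ is called *$t$-approximately strongly regular* if its hyperedges can be partitioned as $\mathcal H=\mathcal H^{(t)}_1\sqcup\dots\sqcup\mathcal H^{(t)}_p$ such that (i) for each $\theta$ there is a set $Q_\theta$ of exactly $t$ vertices contained in every hyperedge of $\mathcal H^{(t)}_\theta$; (ii) $d_t/2\le|\mathcal H^{(t)}_\theta|\le d_t$ for each $\theta$; (iii) $t$ is a *good index* for $(d_1,\dots,d_q)$: $d_r/d_t\le n^{1-2r/q}$ for $1\le r\le\lceil\frac{q-t}{2}\rceil$; $d_r/d_t\le n^{-\frac2q(r-t)+\frac1q(t-\mathbf 1(t\text{ even}))}$ for $t\le r\le\lfloor\frac{q+t}{2}\rfloor$; $d_t\ge d_1n^{-\frac2q(t-1)}$ if $t<q/2$;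 and $d_t\ge d_1n^{-1+2/q}$ if $t>q/2$. For $q$-uniform matchings $\mathcal H_1,\dots,\mathcal H_k$ on $[n]$, let $\mathcal H$ be their union (with multiplicity), so that $|\mathcal H|=\sum_i|\mathcal H_i|$. For $b\in\{\pm1\}^k$ put $$\Psi_b(x)=\sum_{i=1}^k b_i\sum_{C\in\mathcal H_i}\prod_{v\in C}x_v,\qquad \mathrm{val}(\Psi_b)=\max_{x\in\{\pm1\}^n}\Psi_b(x).$$ **Lemma 4.3.** For every positive integer $q$ there is a constant $A>0$, depending only on $q$, such that the following holds. Let $\mathcal H_1,\dots,\mathcal H_k$ be $q$-uniform matchings on $[n]$ whose union $\mathcal H$ is $t$-approximately strongly regular, with $d_1\ge d_2\ge\dots\ge d_q$ defined by $\mathcal H$ as above, and suppose $k\ge d_1\ge\ell$, where $\ell:=n^{1-2/q}\log n$. Then, for $b$ uniformly distributed in $\{\pm1\}^k$, $$\mathbb E_b\left[\mathrm{val}(\Psi_b)^2\right]\le\frac{2|\mathcal H|^2}{d_t}+|\mathcal H|\,n\,\sqrt{k\ell}\,(A\log n)^{1/2}.$$ -/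

import Mathlib

open scoped BigOperators

/-- A hypergraph on the vertex set `Fin n`, parallel hyperedges allowed, is given by a finite
family `e : ι → Finset (Fin n)`: its hyperedges are the indices `a : ι`, and `e a` is the set of
vertices of the hyperedge `a`. The co-degree of `Q` is the number of hyperedges containing `Q`,
counted with multiplicity. -/
def codegree {n : ℕ} {ι : Type*} [Fintype ι] (e : ι → Finset (Fin n)) (Q : Finset (Fin n)) : ℕ :=
  (Finset.univ.filter fun a : ι => Q ⊆ e a).card

/-- `d_r`, the maximum co-degree of a set of exactly `r` vertices. -/
def maxCodegree {n : ℕ} {ι : Type*} [Fintype ι] (e : ι → Finset (Fin n)) (r : ℕ) : ℕ :=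
  (Finset.powersetCard r (Finset.univ : Finset (Fin n))).sup (codegree e)

/-- The index `t` is good with respect to the sequence `d 1, …, d q` (with parameter `n`).
In natural-number arithmetic, with `t ≤ q`, the number `(q - t + 1) / 2` is `⌈(q - t) / 2⌉` and
`(q + t) / 2` is `⌊(q + t) / 2⌋`. -/
structure IsGoodIndex (n q : ℕ) (d : ℕ → ℕ) (t : ℕ) : Prop where
  small : ∀ r : ℕ, 1 ≤ r → r ≤ (q - t + 1) / 2 →
    (d r : ℝ) / d t ≤ (n : ℝ) ^ (1 - 2 * (r : ℝ) / q)
  large : ∀ r : ℕ, t ≤ r → r ≤ (q + t) / 2 →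
    (d r : ℝ) / d t ≤
      (n : ℝ) ^ (-(2 / (q : ℝ)) * ((r : ℝ) - t) + 1 / (q : ℝ) * ((t : ℝ) - if Even t then 1 else 0))
  lower_of_lt : (t : ℝ) < (q : ℝ) / 2 →
    (d 1 : ℝ) * (n : ℝ) ^ (-(2 / (q : ℝ)) * ((t : ℝ) - 1)) ≤ d t
  lower_of_gt : (q : ℝ) / 2 < (t : ℝ) →
    (d 1 : ℝ) * (n : ℝ) ^ (-1 + 2 / (q : ℝ)) ≤ d t

/-- The `q`-uniform hypergraph `e` is `t`-approximately strongly regular, `t ∈ {1, …, q}`.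
The partition of the hyperedges into `p` parts is given by the map `part` that sends
each hyperedge to (the index of) its part. -/
structure IsApproxStronglyRegular {n : ℕ} {ι : Type*} [Fintype ι] (q t : ℕ)
    (e : ι → Finset (Fin n)) : Prop where
  one_le : 1 ≤ t
  le_q : t ≤ q
  uniform : ∀ a : ι, (e a).card = q
  exists_partition : ∃ (p : ℕ) (part : ι → Fin p) (Q : Fin p → Finset (Fin n)),
    (∀ θ, (Q θ).card = t) ∧
    (∀ a, Q (part a) ⊆ e a) ∧
    (∀ θ, (maxCodegree e t : ℝ) / 2 ≤ ((Finset.univ.filter fun a : ι => part a = θ).card : ℝ)) ∧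
    (∀ θ, (Finset.univ.filter fun a : ι => part a = θ).card ≤ maxCodegree e t)
  good : IsGoodIndex n q (maxCodegree e) t

/-- A `q`-uniform matching on `Fin n`: all hyperedges have `q` vertices and distinct hyperedges are
disjoint. -/
def IsUniformMatching {n : ℕ} (q : ℕ) (M : Finset (Finset (Fin n))) : Prop :=
  (∀ C ∈ M, C.card = q) ∧ ∀ C ∈ M, ∀ C' ∈ M, C ≠ C' → Disjoint C C'

/-- The union of `H 1, …, H k` as a hypergraph with parallel hyperedges: there is one hyperedge for
every pair `(i, C)` with `C ∈ H i`. -/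
def unionEdges {n k : ℕ} (H : Fin k → Finset (Finset (Fin n))) :
    (Σ i : Fin k, {C : Finset (Fin n) // C ∈ H i}) → Finset (Fin n) :=
  fun a => a.2.1

/-- `|H|`, the number of hyperedges of the union, counted with multiplicity. -/
def numEdges {n k : ℕ} (H : Fin k → Finset (Finset (Fin n))) : ℕ :=
  ∑ i, (H i).card

/-- The polynomial `Ψ_b(x) = ∑ i, b_i ∑_{C ∈ H i} ∏_{v ∈ C} x_v` at a point of `{±1}ⁿ`; the type
`ℤˣ` is `{1, -1}`. -/
def xorPoly {n k : ℕ} (H : Fin k → Finset (Finset (Fin n))) (b : Fin k → ℤˣ)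
    (x : Fin n → ℤˣ) : ℝ :=
  ∑ i, ((b i : ℤ) : ℝ) * ∑ C ∈ H i, ∏ v ∈ C, ((x v : ℤ) : ℝ)

/-- `val(Ψ_b)`, the maximum of `Ψ_b` over `{±1}ⁿ`. -/
noncomputable def xorVal {n k : ℕ} (H : Fin k → Finset (Finset (Fin n))) (b : Fin k → ℤˣ) : ℝ :=
  Finset.univ.sup' Finset.univ_nonempty (xorPoly H b)

/-- `ℓ = n^{1 - 2/q} log n`. -/
noncomputable def levelParam (n q : ℕ) : ℝ :=
  (n : ℝ) ^ (1 - 2 / (q : ℝ)) * Real.log n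

/-! The core is a spectral estimate for signed polynomials whose monomials are cut into two halves
of `m` letters each. Rows of a Kikuchi matrix are `m`-tuples of words of length `l`, about `2ℓ`; a
monomial joins two rows that carry its halves at the same positions and agree elsewhere. On the
vector of word monomials the quadratic form returns the polynomial. Edges at rows of large degree
are deleted and the rest reweighted, so all row and column sums are small (`expect_kikuchi_le`). A
moment bound for Rademacher sums of matrices (`expect_quadratic_le`) then controls the form, even
when `x` depends on the signs. The input is a count: the monomials of one colour agreeing with a
given one on a set `J` of letters of a half number at most `G n^{1-2|J|/q}`
(`expect_kikuchi_le_of_count`).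

For even `q` the hyperedges are cut in the middle, the count holds with `G = 1` because colour
classes are matchings, and one factor of the square is bounded by `|H|`.

For odd `q`, Cauchy–Schwarz over the `p` parts replaces the square by a sum over pairs `(C, C')` in
a common part, where `p d_t ≤ 2|H|`. The diagonal gives `2|H|²/d_t`. Off the diagonal the monomial
lives on the symmetric difference of `C` and `C'`; pairs are sorted by `m = |C \ C'|`, and each half
takes about `m/2` vertices from either hyperedge. Random signs decouple the product of two colour
signs (`expect_kikuchi_pair_le`), and the good-index inequalities supply the count with `G = d_t`
(`card_pairs_le_rpow`). -/

/-! ### Moments of Rademacher sums. -/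

lemma sum_intUnits {M : Type*} [AddCommMonoid M] (g : ℤˣ → M) : ∑ u : ℤˣ, g u = g 1 + g (-1) := by
  rw [UnitsInt.univ, Finset.sum_pair (by decide)]

lemma sum_signs_prod {k : ℕ} (g : Fin k → ℤˣ → ℝ) :
    ∑ ε : Fin k → ℤˣ, ∏ i, g i (ε i) = ∏ i, ∑ u : ℤˣ, g i u := by
  rw [Finset.prod_univ_sum, Fintype.piFinset_univ]

lemma card_signs (k : ℕ) : (Fintype.card (Fin k → ℤˣ) : ℝ) = 2 ^ k := by
  simp

/-- Exponential moments of a sum of independent signs. -/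
lemma expect_exp_sum_signs_le (k : ℕ) (c : ℝ) :
    (𝔼 ε : Fin k → ℤˣ, Real.exp (c * ∑ i, ((ε i : ℤ) : ℝ))) ≤ Real.exp (k * (c ^ 2 / 2)) := by
  have h : ∑ ε : Fin k → ℤˣ, Real.exp (c * ∑ i, ((ε i : ℤ) : ℝ)) = (2 * Real.cosh c) ^ k := by
    simp_rw [Finset.mul_sum, Real.exp_sum]
    rw [sum_signs_prod (fun _ u => Real.exp (c * ((u : ℤ) : ℝ)))]
    simp [Real.cosh_eq]
    ring
  rw [Fintype.expect_eq_sum_div_card, h, card_signs, mul_pow, mul_div_assoc, mul_comm,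
    div_mul_cancel₀ _ (by positivity), Real.exp_nat_mul]
  gcongr
  exact Real.cosh_le_exp_half_sq c

/-- Even moments of a sum of independent signs. -/
lemma expect_sum_signs_pow_le (k r : ℕ) (hr : 1 ≤ r) :
    (𝔼 ε : Fin k → ℤˣ, (∑ i, ((ε i : ℤ) : ℝ)) ^ (2 * r)) ≤
      2 * (Real.exp 1 * (2 * r) * k) ^ r := by
  rcases Nat.eq_zero_or_pos k with rfl | hk
  · simp
    rw [zero_pow (by omega)]
    positivity
  have hk' : (0 : ℝ) < k := by exact_mod_cast hk
  have hr' : (0 : ℝ) < r := by exact_mod_cast hr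
  -- This `c` minimises `exp(k c² / 2) / c^{2r}`.
  set c : ℝ := √(2 * r / k) with hc
  have hc0 : 0 < c := by positivity
  have hc2 : c ^ 2 = 2 * r / k := Real.sq_sqrt (by positivity)
  have hpt : ∀ s : ℝ, s ^ (2 * r) ≤
      ((2 * r).factorial / c ^ (2 * r)) * (Real.exp (c * s) + Real.exp (-c * s)) := by
    intro s
    have h1 : (c * |s|) ^ (2 * r) / (2 * r).factorial ≤ Real.exp (c * |s|) :=
      Real.pow_div_factorial_le_exp _ (by positivity) _
    have h2 : Real.exp (c * |s|) ≤ Real.exp (c * s) + Real.exp (-c * s) := by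
      rcases abs_cases s with ⟨h, _⟩ | ⟨h, _⟩
      · rw [h]; linarith [Real.exp_pos (-c * s)]
      · rw [h]
        have : c * -s = -c * s := by ring
        rw [this]; linarith [Real.exp_pos (c * s)]
    have h3 : |s| ^ (2 * r) = s ^ (2 * r) := (even_two_mul r).pow_abs s
    rw [mul_pow, h3] at h1
    have h4 := h1.trans h2
    rw [div_le_iff₀ (by positivity)] at h4
    rw [div_mul_eq_mul_div, le_div_iff₀ (by positivity)]
    linarith
  calc (𝔼 ε : Fin k → ℤˣ, (∑ i, ((ε i : ℤ) : ℝ)) ^ (2 * r))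
      ≤ 𝔼 ε : Fin k → ℤˣ, ((2 * r).factorial / c ^ (2 * r)) *
          (Real.exp (c * ∑ i, ((ε i : ℤ) : ℝ)) + Real.exp (-c * ∑ i, ((ε i : ℤ) : ℝ))) :=
        Finset.expect_le_expect fun ε _ => hpt _
    _ ≤ ((2 * r).factorial / c ^ (2 * r)) *
          (Real.exp (k * (c ^ 2 / 2)) + Real.exp (k * (c ^ 2 / 2))) := by
        rw [← Finset.mul_expect, Finset.expect_add_distrib]
        gcongr
        · exact expect_exp_sum_signs_le k c
        · simpa using expect_exp_sum_signs_le k (-c)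
    _ = 2 * (((2 * r).factorial : ℝ) * (k / (2 * r)) ^ r * Real.exp r) := by
        have : (k : ℝ) * (c ^ 2 / 2) = r := by rw [hc2]; field_simp
        rw [this, pow_mul, hc2, div_pow, div_pow]
        field_simp
        ring
    _ ≤ 2 * ((2 * r : ℝ) ^ (2 * r) * (k / (2 * r)) ^ r * Real.exp r) := by
        gcongr
        exact_mod_cast Nat.factorial_le_pow (2 * r)
    _ = _ := by
        have : Real.exp r = Real.exp 1 ^ r := by rw [← Real.exp_nat_mul, mul_one]
        rw [this, pow_mul, ← mul_pow, ← mul_pow]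
        congr 2
        field_simp

/-- By independence the mean is a product of moments of single signs, each 0 or 1. Nonnegativity
allows the traces of words of matrices to be bounded term by term in `expect_trace_pow_le`. -/
lemma expect_signs_word_nonneg {k N : ℕ} (w : Fin N → Fin k) :
    0 ≤ 𝔼 ε : Fin k → ℤˣ, ∏ j, ((ε (w j) : ℤ) : ℝ) := by
  rw [Fintype.expect_eq_sum_div_card]
  refine div_nonneg ?_ (by positivity)
  have h : ∀ ε : Fin k → ℤˣ, ∏ j, ((ε (w j) : ℤ) : ℝ) =
      ∏ i, ((ε i : ℤ) : ℝ) ^ (Finset.univ.filter fun j => w j = i).card := by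
    intro ε
    rw [← Finset.prod_fiberwise Finset.univ w]
    refine Finset.prod_congr rfl fun i _ => ?_
    rw [Finset.prod_congr rfl (g := fun _ => ((ε i : ℤ) : ℝ))]
    · simp
    · intro j hj
      rw [(Finset.mem_filter.1 hj).2]
  simp_rw [h]
  rw [sum_signs_prod fun i u => ((u : ℤ) : ℝ) ^ (Finset.univ.filter fun j => w j = i).card]
  refine Finset.prod_nonneg fun i _ => ?_
  rw [sum_intUnits]
  rcases neg_one_pow_eq_or ℝ (Finset.univ.filter fun j => w j = i).card with h | h <;> simp [h]

/-! ### Moment method for Rademacher sums of matrices. -/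

section Matrix
variable {R : Type*} [Fintype R]
open Matrix

/-- Expansion of a power of a sum into words. -/
lemma sum_pow_eq_sum_words {ι S : Type*} [Fintype ι] [Semiring S] (A : ι → S) (N : ℕ) :
    (∑ i, A i) ^ N = ∑ w : Fin N → ι, (List.ofFn fun j => A (w j)).prod := by
  induction N with
  | zero => simp
  | succ N ih =>
    rw [pow_succ', ih, ← (Fin.consEquiv fun _ => ι).sum_comp, Fintype.sum_prod_type,
      Finset.sum_mul]
    refine Finset.sum_congr rfl fun i _ => ?_
    rw [Finset.mul_sum]
    refine Finset.sum_congr rfl fun w _ => ?_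
    simp [Fin.consEquiv, List.ofFn_succ]

lemma prod_ofFn_smul [DecidableEq R] {N : ℕ} (c : Fin N → ℝ) (A : Fin N → Matrix R R ℝ) :
    (List.ofFn fun j => c j • A j).prod = (∏ j, c j) • (List.ofFn A).prod := by
  induction N with
  | zero => simp
  | succ N ih =>
    rw [List.ofFn_succ, List.prod_cons, ih, List.ofFn_succ, List.prod_cons, Fin.prod_univ_succ]
    simp [smul_smul, mul_comm]

/-- The maximal absolute row sum is a submultiplicative norm. -/
lemma rowSum_prod_le [DecidableEq R] {N : ℕ} {D : ℝ} (A : Fin N → Matrix R R ℝ)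
    (hA : ∀ i s, ∑ s', |A i s s'| ≤ D) (s : R) :
    ∑ s', |(List.ofFn A).prod s s'| ≤ D ^ N := by
  induction N generalizing s with
  | zero => simp [Matrix.one_apply, apply_ite abs]
  | succ N ih =>
    have hD : 0 ≤ D := (Finset.sum_nonneg fun _ _ => abs_nonneg _).trans (hA 0 s)
    rw [List.ofFn_succ, List.prod_cons]
    set B := (List.ofFn fun i : Fin N => A i.succ).prod with hB
    calc ∑ s', |(A 0 * B) s s'| ≤ ∑ s', ∑ u, |A 0 s u| * |B u s'| := by
          refine Finset.sum_le_sum fun s' _ => ?_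
          rw [Matrix.mul_apply]
          refine (Finset.abs_sum_le_sum_abs _ _).trans_eq ?_
          simp_rw [abs_mul]
      _ = ∑ u, |A 0 s u| * ∑ s', |B u s'| := by
          rw [Finset.sum_comm]; simp_rw [Finset.mul_sum]
      _ ≤ ∑ u, |A 0 s u| * D ^ N := by
          gcongr with u _
          exact ih (fun i => A i.succ) (fun i s => hA i.succ s) u
      _ ≤ D * D ^ N := by
          rw [← Finset.sum_mul]
          gcongr
          exact hA 0 s
      _ = D ^ (N + 1) := (pow_succ' D N).symm

/-- The expected trace of a power of a Rademacher sum of matrices. -/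
lemma expect_trace_pow_le [DecidableEq R] {k : ℕ} {D : ℝ} (N : ℕ) (A : Fin k → Matrix R R ℝ)
    (hA : ∀ i s, ∑ s', |A i s s'| ≤ D) :
    (𝔼 ε : Fin k → ℤˣ, ((∑ i, ((ε i : ℤ) : ℝ) • A i) ^ N).trace) ≤
      Fintype.card R * D ^ N * 𝔼 ε : Fin k → ℤˣ, (∑ i, ((ε i : ℤ) : ℝ)) ^ N := by
  have h1 : ∀ ε : Fin k → ℤˣ, ((∑ i, ((ε i : ℤ) : ℝ) • A i) ^ N).trace =
      ∑ w : Fin N → Fin k, (∏ j, ((ε (w j) : ℤ) : ℝ)) * (List.ofFn fun j => A (w j)).prod.trace := by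
    intro ε
    rw [sum_pow_eq_sum_words, Matrix.trace_sum]
    refine Finset.sum_congr rfl fun w _ => ?_
    rw [prod_ofFn_smul, Matrix.trace_smul, smul_eq_mul]
  have h2 : ∀ ε : Fin k → ℤˣ, (∑ i, ((ε i : ℤ) : ℝ)) ^ N =
      ∑ w : Fin N → Fin k, ∏ j, ((ε (w j) : ℤ) : ℝ) := by
    intro ε
    rw [sum_pow_eq_sum_words]
    simp [List.prod_ofFn]
  simp_rw [h1, h2, Finset.expect_sum_comm, Finset.mul_sum]
  refine Finset.sum_le_sum fun w _ => ?_
  rw [← Finset.expect_mul, mul_comm]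
  refine mul_le_mul_of_nonneg_right ?_ (expect_signs_word_nonneg w)
  rw [Matrix.trace]
  calc ∑ s, (List.ofFn fun j => A (w j)).prod.diag s ≤ ∑ _s : R, D ^ N := by
        refine Finset.sum_le_sum fun s _ => ?_
        refine le_trans ?_ (rowSum_prod_le (fun j => A (w j)) (fun i s => hA (w i) s) s)
        refine (le_abs_self _).trans ?_
        exact Finset.single_le_sum (f := fun s' => |(List.ofFn fun j => A (w j)).prod s s'|)
          (fun _ _ => abs_nonneg _) (Finset.mem_univ s)
    _ = _ := by simp

lemma dotProduct_mulVec_symm {M : Matrix R R ℝ} (hM : M.IsSymm) (y z : R → ℝ) :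
    (M *ᵥ y) ⬝ᵥ z = y ⬝ᵥ (M *ᵥ z) := by
  rw [Matrix.dotProduct_mulVec, ← Matrix.mulVec_transpose, hM.eq]

lemma dotProduct_sq_le (y z : R → ℝ) : (y ⬝ᵥ z) ^ 2 ≤ (y ⬝ᵥ y) * (z ⬝ᵥ z) := by
  simpa [dotProduct, sq] using Finset.sum_mul_sq_le_sq_mul_sq Finset.univ y z

lemma quadratic_sq_le [DecidableEq R] {M : Matrix R R ℝ} (hM : M.IsSymm) (y : R → ℝ) :
    (y ⬝ᵥ (M *ᵥ y)) ^ 2 ≤ (y ⬝ᵥ y) * (y ⬝ᵥ ((M ^ 2) *ᵥ y)) := by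
  refine (dotProduct_sq_le y (M *ᵥ y)).trans_eq ?_
  rw [dotProduct_mulVec_symm hM, Matrix.mulVec_mulVec, sq]

lemma dotProduct_self_nonneg_real (y : R → ℝ) : 0 ≤ y ⬝ᵥ y :=
  Finset.sum_nonneg fun _ _ => mul_self_nonneg _

/-- Iterated Cauchy–Schwarz, doubling the power of `M` each time; this replaces an appeal to the
spectral theorem and is why the exponents are powers of two. -/
lemma quadratic_pow_le [DecidableEq R] (a : ℕ) {M : Matrix R R ℝ} (hM : M.IsSymm) (y : R → ℝ) :
    (y ⬝ᵥ (M *ᵥ y)) ^ (2 ^ a) ≤ (y ⬝ᵥ y) ^ (2 ^ a - 1) * (y ⬝ᵥ ((M ^ (2 ^ a)) *ᵥ y)) := by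
  induction a generalizing M with
  | zero => simp
  | succ a ih =>
    have hY := dotProduct_self_nonneg_real y
    have hM2 : (M ^ 2).IsSymm := hM.pow 2
    calc (y ⬝ᵥ (M *ᵥ y)) ^ (2 ^ (a + 1)) = ((y ⬝ᵥ (M *ᵥ y)) ^ 2) ^ (2 ^ a) := by
          rw [← pow_mul, pow_succ']
      _ ≤ ((y ⬝ᵥ y) * (y ⬝ᵥ ((M ^ 2) *ᵥ y))) ^ (2 ^ a) := by
          gcongr
          exact quadratic_sq_le hM y
      _ = (y ⬝ᵥ y) ^ (2 ^ a) * (y ⬝ᵥ ((M ^ 2) *ᵥ y)) ^ (2 ^ a) := mul_pow _ _ _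
      _ ≤ (y ⬝ᵥ y) ^ (2 ^ a) *
            ((y ⬝ᵥ y) ^ (2 ^ a - 1) * (y ⬝ᵥ (((M ^ 2) ^ (2 ^ a)) *ᵥ y))) := by
          gcongr
          exact ih hM2
      _ = _ := by
          rw [← mul_assoc, ← pow_add, ← pow_mul, ← pow_succ']
          congr 2
          have := Nat.one_le_two_pow (n := a)
          rw [pow_succ]; omega

/-- The operator norm is at most the Frobenius norm: Cauchy–Schwarz in each row. -/
lemma quadratic_sq_le_trace [DecidableEq R] {B : Matrix R R ℝ} (hB : B.IsSymm) (y : R → ℝ) :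
    y ⬝ᵥ ((B ^ 2) *ᵥ y) ≤ (y ⬝ᵥ y) * (B ^ 2).trace := by
  rw [sq, ← Matrix.mulVec_mulVec, ← dotProduct_mulVec_symm hB]
  have h : (B * B).trace = ∑ s, B s ⬝ᵥ B s := by
    simp only [Matrix.trace, Matrix.diag, Matrix.mul_apply, dotProduct]
    refine Finset.sum_congr rfl fun s _ => Finset.sum_congr rfl fun s' _ => ?_
    rw [hB.apply]
  rw [h, Finset.mul_sum]
  refine Finset.sum_le_sum fun s _ => ?_
  rw [← sq, mul_comm (y ⬝ᵥ y)]
  exact dotProduct_sq_le (B s) y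

lemma quadratic_pow_le_trace [DecidableEq R] (a : ℕ) {M : Matrix R R ℝ} (hM : M.IsSymm) (y : R → ℝ) :
    (y ⬝ᵥ (M *ᵥ y)) ^ (2 ^ (a + 1)) ≤ (y ⬝ᵥ y) ^ (2 ^ (a + 1)) * (M ^ (2 ^ (a + 1))).trace := by
  have hY := dotProduct_self_nonneg_real y
  refine (quadratic_pow_le (a + 1) hM y).trans ?_
  have h : M ^ 2 ^ (a + 1) = (M ^ 2 ^ a) ^ 2 := by rw [← pow_mul, pow_succ]
  rw [h]
  calc _ ≤ (y ⬝ᵥ y) ^ (2 ^ (a + 1) - 1) * ((y ⬝ᵥ y) * ((M ^ 2 ^ a) ^ 2).trace) := by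
        gcongr
        exact quadratic_sq_le_trace (hM.pow _) y
    _ = _ := by
        rw [← mul_assoc, pow_sub_one_mul (by positivity)]

lemma expect_pow_le_expect_pow {Ω : Type*} [Fintype Ω] [Nonempty Ω] (f : Ω → ℝ) {N : ℕ}
    (hN : Even N) : (𝔼 ω, f ω) ^ N ≤ 𝔼 ω, f ω ^ N := by
  have h := Real.pow_arith_mean_le_arith_mean_pow_of_even Finset.univ
    (fun _ : Ω => (Fintype.card Ω : ℝ)⁻¹) f (fun _ _ => by positivity)
    (by simp) hN
  simpa [Fintype.expect_eq_sum_div_card, ← Finset.mul_sum, div_eq_inv_mul] using h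

/-- A crude matrix Khintchine inequality: the typical size of the quadratic form of a Rademacher sum
of matrices with bounded rows and columns. -/
lemma expect_quadratic_le [Nonempty R] {k : ℕ} {D : ℝ} (A : Fin k → Matrix R R ℝ)
    (hrow : ∀ i s, ∑ s', |A i s s'| ≤ D) (hcol : ∀ i s', ∑ s, |A i s s'| ≤ D)
    (y : (Fin k → ℤˣ) → R → ℝ) (hy : ∀ ε s, |y ε s| ≤ 1) :
    (𝔼 ε : Fin k → ℤˣ, ∑ i, ((ε i : ℤ) : ℝ) * (y ε ⬝ᵥ (A i *ᵥ y ε))) ≤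
      Fintype.card R * D * √(54 * (k * (Real.log (Fintype.card R) + 1))) := by
  classical
  have hN1 : (1 : ℝ) ≤ (Fintype.card R : ℝ) := by exact_mod_cast Fintype.card_pos
  set N : ℝ := (Fintype.card R : ℝ) with hN
  have hlog : 0 ≤ Real.log N := Real.log_nonneg hN1
  rcases Nat.eq_zero_or_pos k with rfl | hk
  · simp
  have hD : 0 ≤ D := (Finset.sum_nonneg fun _ _ => abs_nonneg _).trans
    (hrow ⟨0, hk⟩ (Classical.arbitrary R))
  -- The moment `2^(a+1)` exceeds `log N + 1`, so the dimension factor in the trace costs only a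
  -- constant after taking the root, and it is at most twice `log N + 1`.
  obtain ⟨a, ha1, ha2⟩ := exists_nat_pow_near (x := Real.log N + 1) (by linarith)
    (one_lt_two : (1 : ℝ) < 2)
  -- Symmetrising leaves the quadratic form unchanged, and its row sums average a row sum and a
  -- column sum of `A i`.
  set B : Fin k → Matrix R R ℝ := fun i => (1 / 2 : ℝ) • (A i + (A i)ᵀ) with hB
  have hBsymm : ∀ i, (B i).IsSymm := fun i => by
    rw [hB]
    exact (Matrix.isSymm_add_transpose_self (A i)).smul _
  have hBrow : ∀ i s, ∑ s', |B i s s'| ≤ D := by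
    intro i s
    calc ∑ s', |B i s s'| ≤ ∑ s', (1 / 2 : ℝ) * (|A i s s'| + |A i s' s|) := by
          refine Finset.sum_le_sum fun s' _ => ?_
          simp only [hB, Matrix.smul_apply, Matrix.add_apply, Matrix.transpose_apply, smul_eq_mul,
            abs_mul]
          rw [abs_of_nonneg (by norm_num : (0 : ℝ) ≤ 1 / 2)]
          gcongr
          exact abs_add_le _ _
      _ ≤ D := by
          rw [← Finset.mul_sum, Finset.sum_add_distrib]
          linarith [hrow i s, hcol i s]
  have hquad : ∀ ε : Fin k → ℤˣ, ∑ i, ((ε i : ℤ) : ℝ) * (y ε ⬝ᵥ (A i *ᵥ y ε)) =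
      y ε ⬝ᵥ ((∑ i, ((ε i : ℤ) : ℝ) • B i) *ᵥ y ε) := by
    intro ε
    rw [Matrix.sum_mulVec, dotProduct_sum]
    refine Finset.sum_congr rfl fun i _ => ?_
    rw [Matrix.smul_mulVec, dotProduct_smul, smul_eq_mul]
    congr 1
    simp only [hB, Matrix.smul_mulVec, dotProduct_smul, Matrix.add_mulVec, dotProduct_add]
    rw [Matrix.mulVec_transpose, dotProduct_comm (y ε) (y ε ᵥ* A i), ← Matrix.dotProduct_mulVec,
      smul_eq_mul]
    ring
  simp_rw [hquad]
  have hsymm : ∀ ε : Fin k → ℤˣ, (∑ i, ((ε i : ℤ) : ℝ) • B i).IsSymm := by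
    intro ε
    refine Matrix.IsSymm.ext fun s s' => ?_
    simp only [Matrix.sum_apply, Matrix.smul_apply, (hBsymm _).apply s s']
  have hY : ∀ ε, y ε ⬝ᵥ y ε ≤ N := by
    intro ε
    calc y ε ⬝ᵥ y ε ≤ ∑ _s : R, (1 : ℝ) := by
          refine Finset.sum_le_sum fun s _ => ?_
          rw [← sq, ← sq_abs]
          exact pow_le_one₀ (abs_nonneg _) (hy ε s)
      _ = N := by simp [hN]
  have htr : ∀ ε : Fin k → ℤˣ, 0 ≤ ((∑ i, ((ε i : ℤ) : ℝ) • B i) ^ (2 ^ (a + 1))).trace := by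
    intro ε
    have h : (∑ i, ((ε i : ℤ) : ℝ) • B i) ^ (2 ^ (a + 1)) =
        (∑ i, ((ε i : ℤ) : ℝ) • B i) ^ (2 ^ a) * (∑ i, ((ε i : ℤ) : ℝ) • B i) ^ (2 ^ a) := by
      rw [← pow_add, pow_succ, mul_two]
    have hs := (hsymm ε).pow (2 ^ a)
    rw [h]
    refine Finset.sum_nonneg fun s _ => ?_
    rw [Matrix.diag_apply, Matrix.mul_apply]
    refine Finset.sum_nonneg fun s' _ => ?_
    rw [hs.apply]
    exact mul_self_nonneg _
  have hr : (2 : ℕ) ^ (a + 1) = 2 * 2 ^ a := pow_succ' 2 a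
  have heven : Even ((2 : ℕ) ^ (a + 1)) := by rw [hr]; exact even_two_mul _
  set T : ℝ := N * D * √(54 * (k * (Real.log N + 1))) with hT
  have hT0 : 0 ≤ T := by positivity
  have key : (𝔼 ε : Fin k → ℤˣ, y ε ⬝ᵥ ((∑ i, ((ε i : ℤ) : ℝ) • B i) *ᵥ y ε)) ^ (2 ^ (a + 1)) ≤
      T ^ (2 ^ (a + 1)) := by
    calc _ ≤ 𝔼 ε : Fin k → ℤˣ,
            (y ε ⬝ᵥ ((∑ i, ((ε i : ℤ) : ℝ) • B i) *ᵥ y ε)) ^ (2 ^ (a + 1)) :=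
          expect_pow_le_expect_pow _ heven
      _ ≤ 𝔼 ε : Fin k → ℤˣ,
            N ^ (2 ^ (a + 1)) * ((∑ i, ((ε i : ℤ) : ℝ) • B i) ^ (2 ^ (a + 1))).trace := by
          refine Finset.expect_le_expect fun ε _ => ?_
          refine (quadratic_pow_le_trace a (hsymm ε) (y ε)).trans ?_
          have h0 := dotProduct_self_nonneg_real (y ε)
          gcongr
          · exact htr ε
          · exact hY ε
      _ ≤ N ^ (2 ^ (a + 1)) * (N * D ^ (2 ^ (a + 1)) *
            (2 * (Real.exp 1 * (2 * (2 ^ a : ℕ)) * k) ^ (2 ^ a))) := by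
          rw [← Finset.mul_expect]
          gcongr
          refine (expect_trace_pow_le _ B hBrow).trans ?_
          gcongr
          have := expect_sum_signs_pow_le k (2 ^ a) Nat.one_le_two_pow
          rwa [← hr] at this
      _ = (N * D) ^ (2 ^ (a + 1)) *
            ((N * 2) * (Real.exp 1 * (2 * (2 ^ a : ℕ)) * k) ^ (2 ^ a)) := by
          rw [mul_pow]; ring
      -- Here `2N ≤ e^{log N + 1} ≤ 9^{2^a}`, while `e ≤ 3` and `2^a ≤ log N + 1`; hence the
      -- constant `54 = 9 · 3 · 2`.
      _ ≤ (N * D) ^ (2 ^ (a + 1)) *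
            ((3 ^ 2) ^ (2 ^ a) * (3 * (2 * (Real.log N + 1)) * k) ^ (2 ^ a)) := by
          have he3 : Real.exp 1 ≤ 3 := by linarith [Real.exp_one_lt_d9]
          gcongr
          · rw [← pow_mul, ← hr]
            calc N * 2 ≤ Real.exp (Real.log N) * Real.exp 1 := by
                  rw [Real.exp_log (by linarith)]
                  gcongr
                  linarith [Real.exp_one_gt_d9]
              _ = Real.exp (Real.log N + 1) := (Real.exp_add _ _).symm
              _ ≤ Real.exp (((2 : ℕ) ^ (a + 1) : ℕ) : ℝ) := by
                  refine Real.exp_le_exp.2 ?_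
                  push_cast
                  exact ha2.le
              _ = Real.exp 1 ^ (2 ^ (a + 1)) := by rw [← Real.exp_nat_mul, mul_one]
              _ ≤ 3 ^ (2 ^ (a + 1)) := by gcongr
          · push_cast
            exact ha1
      _ = T ^ (2 ^ (a + 1)) := by
          rw [hT, mul_pow (N * D), hr, pow_mul (√_), Real.sq_sqrt (by positivity), ← mul_pow]
          congr 2
          ring
  exact le_of_abs_le ((pow_le_pow_iff_left₀ (n := 2 ^ (a + 1)) (abs_nonneg _) hT0 (by positivity)).1
    (by rwa [heven.pow_abs]))
end Matrix

/-! ### Kikuchi matrices indexed by tuples of words. -/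

section Kikuchi
variable {n m l : ℕ}

/-- Write the letter `v j` at the position `f j` of the word `T j`, for every `j`. -/
def plant (f : Fin m → Fin l) (v : Fin m → Fin n) (T : Fin m → Fin l → Fin n) :
    Fin m → Fin l → Fin n :=
  fun j => Function.update (T j) (f j) (v j)

/-- The number of choices of one position in every word `S j` at which the letter is `v j`. -/
def occurrences (S : Fin m → Fin l → Fin n) (v : Fin m → Fin n) : ℝ :=
  ∏ j, ∑ p, if S j p = v j then 1 else 0

lemma occurrences_nonneg (S : Fin m → Fin l → Fin n) (v : Fin m → Fin n) :
    0 ≤ occurrences S v :=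
  Finset.prod_nonneg fun _ _ => Finset.sum_nonneg fun _ _ => by split_ifs <;> norm_num

lemma occurrences_eq_sum (S : Fin m → Fin l → Fin n) (v : Fin m → Fin n) :
    occurrences S v = ∑ f : Fin m → Fin l, if ∀ j, S j (f j) = v j then (1 : ℝ) else 0 := by
  rw [occurrences, Finset.prod_univ_sum, Fintype.piFinset_univ]
  refine Finset.sum_congr rfl fun f _ => ?_
  rw [Finset.prod_ite_zero]
  simp

lemma sum_word_eq (p : Fin l) (u : Fin n) :
    ∑ w : Fin l → Fin n, (if w p = u then (1 : ℝ) else 0) = (n : ℝ) ^ l / n := by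
  have hn : 0 < n := u.pos
  have hl : 0 < l := p.pos
  have h := Fintype.card_filter_piFinset_const_eq_of_mem (Finset.univ : Finset (Fin n)) p
    (Finset.mem_univ u)
  rw [Fintype.piFinset_univ] at h
  rw [Finset.sum_boole, h, eq_div_iff (by positivity)]
  simp only [Finset.card_univ, Fintype.card_fin]
  push_cast
  rw [← pow_succ, Nat.sub_add_cancel hl]

/-- In a uniform word with `v` planted at `p₀`, every other position shows `u` with probability
`1/n`, and `p₀` shows it exactly when `u = v`. -/
lemma sum_update_word_le (p₀ : Fin l) (v u : Fin n) :
    ∑ w : Fin l → Fin n, ∑ p, (if Function.update w p₀ v p = u then (1 : ℝ) else 0) ≤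
      (n : ℝ) ^ l * ((l : ℝ) / n + if u = v then 1 else 0) := by
  have hn : 0 < n := u.pos
  rw [Finset.sum_comm]
  calc ∑ p, ∑ w : Fin l → Fin n, (if Function.update w p₀ v p = u then (1 : ℝ) else 0)
      ≤ ∑ p, ((n : ℝ) ^ l / n + if p = p₀ then (n : ℝ) ^ l * (if u = v then 1 else 0) else 0) := by
        refine Finset.sum_le_sum fun p _ => ?_
        by_cases hp : p = p₀
        · subst hp
          have : 0 ≤ (n : ℝ) ^ l / n := by positivity
          by_cases huv : u = v
          · simp [huv]; exact this
          · simp [huv, Ne.symm huv]; exact this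
        · simp only [Function.update_of_ne hp, sum_word_eq, if_neg hp, add_zero, le_refl]
    _ = _ := by
        rw [Finset.sum_add_distrib, Finset.sum_ite_eq' Finset.univ p₀, if_pos (Finset.mem_univ _)]
        simp only [Finset.sum_const, Finset.card_univ, Fintype.card_fin, nsmul_eq_mul]
        ring

lemma card_words : (Fintype.card (Fin m → Fin l → Fin n) : ℝ) = ((n : ℝ) ^ l) ^ m := by
  simp

lemma sum_occurrences_plant_le (f : Fin m → Fin l) (v u : Fin m → Fin n) :
    ∑ T : Fin m → Fin l → Fin n, occurrences (plant f v T) u ≤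
      ((n : ℝ) ^ l) ^ m * ∏ j, ((l : ℝ) / n + if u j = v j then 1 else 0) := by
  have h : ∑ T : Fin m → Fin l → Fin n, occurrences (plant f v T) u =
      ∏ j, ∑ w : Fin l → Fin n, ∑ p,
        (if Function.update w (f j) (v j) p = u j then (1 : ℝ) else 0) := by
    rw [Finset.prod_univ_sum, Fintype.piFinset_univ]
    rfl
  rw [h]
  calc _ ≤ ∏ j : Fin m, ((n : ℝ) ^ l * ((l : ℝ) / n + if u j = v j then 1 else 0)) := by
        refine Finset.prod_le_prod (fun j _ => ?_) fun j _ => sum_update_word_le _ _ _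
        exact Finset.sum_nonneg fun _ _ => Finset.sum_nonneg fun _ _ => by split_ifs <;> norm_num
    _ = _ := by rw [Finset.prod_mul_distrib]; simp

/-- Planting forgets only the `m` overwritten letters. -/
lemma card_plant_fiber_le (f : Fin m → Fin l) (v : Fin m → Fin n) (S : Fin m → Fin l → Fin n) :
    ∑ T : Fin m → Fin l → Fin n, (if plant f v T = S then (1 : ℝ) else 0) ≤
      (n : ℝ) ^ m * if ∀ j, S j (f j) = v j then 1 else 0 := by
  by_cases h : ∀ j, S j (f j) = v j
  · rw [if_pos h, Finset.sum_boole, mul_one]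
    have := Finset.card_le_card_of_injOn (s := Finset.univ.filter fun T => plant f v T = S)
      (t := (Finset.univ : Finset (Fin m → Fin n))) (fun T j => T j (f j))
      (fun _ _ => Finset.mem_coe.2 (Finset.mem_univ _)) (by
        intro T hT T' hT' hTT'
        have e : plant f v T = plant f v T' := by
          rw [(Finset.mem_filter.1 hT).2, (Finset.mem_filter.1 hT').2]
        funext j p
        by_cases hp : p = f j
        · rw [hp]; exact congrFun hTT' j
        · have := congrFun (congrFun e j) p
          simpa [plant, Function.update_of_ne hp] using this)
    have h2 : (Finset.univ.filter fun T => plant f v T = S).card ≤ n ^ m := by simpa using this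
    exact_mod_cast h2
  · rw [if_neg h, mul_zero]
    refine (Finset.sum_eq_zero fun T _ => if_neg ?_).le
    rintro rfl
    exact h fun j => by simp [plant]

/-- Markov's inequality for the counting measure. -/
lemma card_four_mul_lt_le {X : Type*} [Fintype X] (g : X → ℝ) (hg : ∀ x, 0 ≤ g x) {μ : ℝ}
    (hμ : 0 < μ) (h : ∑ x, g x ≤ Fintype.card X * μ) :
    ((Finset.univ.filter fun x => 4 * μ < g x).card : ℝ) ≤ Fintype.card X / 4 := by
  have h1 : ((Finset.univ.filter fun x => 4 * μ < g x).card : ℝ) * (4 * μ) ≤ ∑ x, g x := by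
    rw [← nsmul_eq_mul]
    refine (Finset.card_nsmul_le_sum _ g _ fun x hx => (Finset.mem_filter.1 hx).2.le).trans ?_
    exact Finset.sum_le_sum_of_subset_of_nonneg (Finset.subset_univ _) fun x _ _ => hg x
  rw [le_div_iff₀ (by norm_num)]
  refine le_of_mul_le_mul_right ?_ hμ
  linarith

/-- The monomial of a tuple of words. -/
def wordMonomial (x : Fin n → ℝ) (S : Fin m → Fin l → Fin n) : ℝ := ∏ j, ∏ p, x (S j p)

/-- Letters at the other positions occur in both tuples and square to 1. -/
lemma wordMonomial_plant_mul {x : Fin n → ℝ} (hx : ∀ v, x v * x v = 1) (f : Fin m → Fin l)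
    (v v' : Fin m → Fin n) (T : Fin m → Fin l → Fin n) :
    wordMonomial x (plant f v T) * wordMonomial x (plant f v' T) = ∏ j, x (v j) * x (v' j) := by
  rw [wordMonomial, wordMonomial, ← Finset.prod_mul_distrib]
  refine Finset.prod_congr rfl fun j _ => ?_
  rw [← Finset.prod_mul_distrib, Finset.prod_eq_single (f j)]
  · simp [plant]
  · intro p _ hp
    simp [plant, Function.update_of_ne hp, hx]
  · simp

variable {k : ℕ} {ι : Type*} [Fintype ι]

/-- The degree of the row `S` in the Kikuchi graph of the colour `i`. -/
def kikuchiDegree (col : ι → Fin k) (z : ι → Fin m → Fin n) (i : Fin k)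
    (S : Fin m → Fin l → Fin n) : ℝ :=
  ∑ α with col α = i, occurrences S (z α)

lemma kikuchiDegree_nonneg (col : ι → Fin k) (z : ι → Fin m → Fin n) (i : Fin k)
    (S : Fin m → Fin l → Fin n) : 0 ≤ kikuchiDegree col z i S :=
  Finset.sum_nonneg fun _ _ => occurrences_nonneg _ _

/-- Few rows that carry a given clause have a large degree. -/
lemma card_large_degree_le (hn : 1 ≤ n) (hl : 1 ≤ l) (col : ι → Fin k) (z : ι → Fin m → Fin n)
    {D : ℝ} (hD : 0 < D) (α₀ : ι)
    (hz : ∑ α with col α = col α₀, ∏ j, ((l : ℝ) / n + if z α j = z α₀ j then 1 else 0) ≤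
      D * ((l : ℝ) / n) ^ m) (f : Fin m → Fin l) :
    ((Finset.univ.filter fun T => 4 * (D * ((l : ℝ) / n) ^ m) <
      kikuchiDegree col z (col α₀) (plant f (z α₀) T)).card : ℝ) ≤ ((n : ℝ) ^ l) ^ m / 4 := by
  rw [← card_words]
  refine card_four_mul_lt_le _ (fun _ => kikuchiDegree_nonneg _ _ _ _) (by positivity) ?_
  simp_rw [kikuchiDegree]
  rw [Finset.sum_comm]
  calc _ ≤ ∑ α with col α = col α₀,
          ((n : ℝ) ^ l) ^ m * ∏ j, ((l : ℝ) / n + if z α j = z α₀ j then 1 else 0) :=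
        Finset.sum_le_sum fun α _ => sum_occurrences_plant_le _ _ _
    _ ≤ _ := by
        rw [← Finset.mul_sum, card_words]
        gcongr

/-- A row of degree above `B` carries no kept edge. At any other row each occurrence of a half comes
from at most `n^m` tuples `T`. -/
lemma sum_kept_edges_le (col : ι → Fin k) (z : ι → Fin m → Fin n)
    (kept : ι → Finset ((Fin m → Fin l) × (Fin m → Fin l → Fin n))) {B W : ℝ} (hW : 0 ≤ W)
    (hB : 0 ≤ B)
    (hkept : ∀ α, ∀ e ∈ kept α, kikuchiDegree col z (col α) (plant e.1 (z α) e.2) ≤ B)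
    (i : Fin k) (S : Fin m → Fin l → Fin n) :
    ∑ α with col α = i, ∑ e ∈ kept α, (if plant e.1 (z α) e.2 = S then W else 0) ≤
      W * ((n : ℝ) ^ m * B) := by
  by_cases hS : kikuchiDegree col z i S ≤ B
  · calc _ ≤ ∑ α with col α = i, ∑ f : Fin m → Fin l, ∑ T : Fin m → Fin l → Fin n,
            W * (if plant f (z α) T = S then (1 : ℝ) else 0) := by
          refine Finset.sum_le_sum fun α _ => ?_
          rw [← Fintype.sum_prod_type']
          refine (Finset.sum_le_sum_of_subset_of_nonneg (Finset.subset_univ _) ?_).trans_eq ?_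
          · intro e _ _
            split_ifs <;> simp [hW]
          · simp
      _ ≤ ∑ α with col α = i, ∑ f : Fin m → Fin l,
            W * ((n : ℝ) ^ m * if ∀ j, S j (f j) = z α j then 1 else 0) := by
          refine Finset.sum_le_sum fun α _ => Finset.sum_le_sum fun f _ => ?_
          rw [← Finset.mul_sum]
          gcongr
          exact card_plant_fiber_le _ _ _
      _ = W * ((n : ℝ) ^ m * kikuchiDegree col z i S) := by
          simp_rw [kikuchiDegree, occurrences_eq_sum, Finset.mul_sum]
      _ ≤ _ := by gcongr
  · refine le_trans (Finset.sum_nonpos fun α hα => Finset.sum_nonpos fun e he => ?_)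
      (by positivity)
    rw [if_neg]
    rintro rfl
    rw [← (Finset.mem_filter.1 hα).2] at hS
    exact hS (hkept α e he)

/-- The spectral bound from Kikuchi matrices, for a polynomial whose monomials `α` carry the sign of
their colour `col α` and are split into two halves `z α` and `z' α`. The hypotheses bound the
conditional expectation of a degree in the Kikuchi graph of one colour. -/
lemma expect_kikuchi_le (hn : 1 ≤ n) (hl : 1 ≤ l) (col : ι → Fin k) (z z' : ι → Fin m → Fin n)
    (c : ι → ℝ) (hc : ∀ α, |c α| ≤ 1) {D : ℝ} (hD : 0 < D)
    (hz : ∀ α₀, ∑ α with col α = col α₀,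
      ∏ j, ((l : ℝ) / n + if z α j = z α₀ j then 1 else 0) ≤ D * ((l : ℝ) / n) ^ m)
    (hz' : ∀ α₀, ∑ α with col α = col α₀,
      ∏ j, ((l : ℝ) / n + if z' α j = z' α₀ j then 1 else 0) ≤ D * ((l : ℝ) / n) ^ m)
    (x : (Fin k → ℤˣ) → Fin n → ℤˣ) :
    (𝔼 ε : Fin k → ℤˣ, ∑ α, ((ε (col α) : ℤ) : ℝ) *
      (c α * ∏ j, ((x ε (z α j) : ℤ) : ℝ) * ((x ε (z' α j) : ℤ) : ℝ))) ≤
      8 * D * √(54 * (k * (m * l * Real.log n + 1))) := by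
  classical
  have : NeZero n := ⟨by omega⟩
  have : NeZero l := ⟨by omega⟩
  have hn' : (0 : ℝ) < n := by exact_mod_cast hn
  have hl' : (0 : ℝ) < l := by exact_mod_cast hl
  set N : ℝ := ((n : ℝ) ^ l) ^ m with hN
  have hN0 : 0 < N := by positivity
  set B : ℝ := 4 * (D * ((l : ℝ) / n) ^ m) with hB
  have hB0 : 0 < B := by positivity
  -- An edge is kept when both its ends have degree at most four times the bound on the conditional
  -- mean. By Markov each end fails for at most a quarter of the `T`, so at least half survive.
  set kept : ι → Finset ((Fin m → Fin l) × (Fin m → Fin l → Fin n)) := fun α =>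
    Finset.univ.filter fun e => kikuchiDegree col z (col α) (plant e.1 (z α) e.2) ≤ B ∧
      kikuchiDegree col z' (col α) (plant e.1 (z' α) e.2) ≤ B with hkept
  have hcard : ∀ α, (l : ℝ) ^ m * (N / 2) ≤ ((kept α).card : ℝ) := by
    intro α
    have h1 : ∀ f : Fin m → Fin l, N / 2 ≤ ((Finset.univ.filter fun T =>
        kikuchiDegree col z (col α) (plant f (z α) T) ≤ B ∧
        kikuchiDegree col z' (col α) (plant f (z' α) T) ≤ B).card : ℝ) := by
      intro f
      have e1 := card_large_degree_le hn hl col z hD α (hz α) f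
      have e2 := card_large_degree_le hn hl col z' hD α (hz' α) f
      have e3 : (Finset.univ : Finset (Fin m → Fin l → Fin n)) ⊆
          (Finset.univ.filter fun T =>
            kikuchiDegree col z (col α) (plant f (z α) T) ≤ B ∧
            kikuchiDegree col z' (col α) (plant f (z' α) T) ≤ B) ∪
          ((Finset.univ.filter fun T => B < kikuchiDegree col z (col α) (plant f (z α) T)) ∪
          (Finset.univ.filter fun T => B < kikuchiDegree col z' (col α) (plant f (z' α) T))) := by
        intro T _
        simp only [Finset.mem_union, Finset.mem_filter, Finset.mem_univ, true_and]
        by_contra! h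
        exact absurd (h.1 h.2.1) (not_lt.2 h.2.2)
      have e4 := (Finset.card_le_card e3).trans ((Finset.card_union_le _ _).trans
        (Nat.add_le_add_left (Finset.card_union_le _ _) _))
      have e5 := (Nat.cast_le (α := ℝ)).2 e4
      rw [Finset.card_univ, card_words] at e5
      push_cast at e5
      linarith
    calc (l : ℝ) ^ m * (N / 2) = ∑ _f : Fin m → Fin l, N / 2 := by simp
      _ ≤ ∑ f : Fin m → Fin l, ((Finset.univ.filter fun T =>
            kikuchiDegree col z (col α) (plant f (z α) T) ≤ B ∧
            kikuchiDegree col z' (col α) (plant f (z' α) T) ≤ B).card : ℝ) :=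
          Finset.sum_le_sum fun f _ => h1 f
      _ = ((kept α).card : ℝ) := by
          simp_rw [hkept, Finset.card_filter]
          push_cast
          rw [← Fintype.sum_prod_type']
  set W : ℝ := 2 / ((l : ℝ) ^ m * N) with hW
  have hW0 : 0 ≤ W := by positivity
  have hcard0 : ∀ α, 0 < ((kept α).card : ℝ) := fun α => lt_of_lt_of_le (by positivity) (hcard α)
  have hw : ∀ α, |c α / (kept α).card| ≤ W := by
    intro α
    rw [abs_div, Nat.abs_cast, hW]
    have h := hcard α
    rw [div_le_div_iff₀ (hcard0 α) (by positivity)]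
    have := hc α
    nlinarith [hcard0 α, mul_pos (pow_pos hl' m) hN0]
  -- Dividing by the monomial's own number of kept edges gives it total weight exactly `c α`, so
  -- deletion does not change the quadratic form. The lower bound on that number makes each weight
  -- at most `W`.
  set A : Fin k → Matrix (Fin m → Fin l → Fin n) (Fin m → Fin l → Fin n) ℝ := fun i S S' =>
    ∑ α with col α = i, ∑ e ∈ kept α, if plant e.1 (z α) e.2 = S then
      (if plant e.1 (z' α) e.2 = S' then c α / (kept α).card else 0) else 0 with hA
  have hWB : W * ((n : ℝ) ^ m * B) = 8 * D / N := by
    rw [hW, hB, div_pow]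
    field_simp
    norm_num
  have hAabs : ∀ i S S', |A i S S'| ≤ ∑ α with col α = i, ∑ e ∈ kept α,
      if plant e.1 (z α) e.2 = S then (if plant e.1 (z' α) e.2 = S' then W else 0) else 0 := by
    intro i S S'
    refine (Finset.abs_sum_le_sum_abs _ _).trans (Finset.sum_le_sum fun α _ => ?_)
    refine (Finset.abs_sum_le_sum_abs _ _).trans (Finset.sum_le_sum fun e _ => ?_)
    split_ifs
    · exact hw α
    · simp
    · simp
  have hrow : ∀ i S, ∑ S', |A i S S'| ≤ 8 * D / N := by
    intro i S
    rw [← hWB]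
    refine (Finset.sum_le_sum fun S' _ => hAabs i S S').trans ?_
    rw [Finset.sum_comm]
    refine le_trans (Finset.sum_le_sum fun α _ => ?_)
      (sum_kept_edges_le col z kept hW0 hB0.le
        (fun α e he => (Finset.mem_filter.1 he).2.1) i S)
    rw [Finset.sum_comm]
    refine Finset.sum_le_sum fun e _ => ?_
    split_ifs <;> simp
  have hcol : ∀ i S', ∑ S, |A i S S'| ≤ 8 * D / N := by
    intro i S'
    rw [← hWB]
    refine (Finset.sum_le_sum fun S _ => hAabs i S S').trans ?_
    rw [Finset.sum_comm]
    refine le_trans (Finset.sum_le_sum fun α _ => ?_)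
      (sum_kept_edges_le col z' kept hW0 hB0.le
        (fun α e he => (Finset.mem_filter.1 he).2.2) i S')
    rw [Finset.sum_comm]
    refine Finset.sum_le_sum fun e _ => ?_
    simp
  have hsq : ∀ u : ℤˣ, ((u : ℤ) : ℝ) * ((u : ℤ) : ℝ) = 1 := by
    intro u
    rcases Int.units_eq_one_or u with rfl | rfl <;> simp
  have habs : ∀ u : ℤˣ, |((u : ℤ) : ℝ)| = 1 := by
    intro u
    rcases Int.units_eq_one_or u with rfl | rfl <;> simp
  have main := expect_quadratic_le A hrow hcol
    (fun ε => wordMonomial fun v => ((x ε v : ℤ) : ℝ)) (fun ε S => by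
      simp [wordMonomial, Finset.abs_prod, habs])
  have hcardR : (Fintype.card (Fin m → Fin l → Fin n) : ℝ) = N := card_words
  have hlog : Real.log N = m * l * Real.log n := by
    rw [hN, Real.log_pow, Real.log_pow]; ring
  rw [hcardR, hlog, mul_div_cancel₀ _ hN0.ne'] at main
  refine le_trans (le_of_eq ?_) main
  refine Finset.expect_congr rfl fun ε _ => ?_
  set y := wordMonomial (m := m) (l := l) fun v => ((x ε v : ℤ) : ℝ) with hy
  have hquad : ∀ i, dotProduct y (Matrix.mulVec (A i) y) =
      ∑ α with col α = i, c α * ∏ j, ((x ε (z α j) : ℤ) : ℝ) * ((x ε (z' α j) : ℤ) : ℝ) := by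
    intro i
    have h1 : dotProduct y (Matrix.mulVec (A i) y) = ∑ α with col α = i, ∑ e ∈ kept α,
        y (plant e.1 (z α) e.2) * (c α / (kept α).card * y (plant e.1 (z' α) e.2)) := by
      simp only [dotProduct, Matrix.mulVec, hA, Finset.sum_mul, Finset.mul_sum]
      calc _ = ∑ S, ∑ α with col α = i, ∑ e ∈ kept α, ∑ S', y S *
              ((if plant e.1 (z α) e.2 = S then
                (if plant e.1 (z' α) e.2 = S' then c α / (kept α).card else 0) else 0) * y S') := by
            refine Finset.sum_congr rfl fun S _ => ?_
            rw [Finset.sum_comm]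
            refine Finset.sum_congr rfl fun α _ => ?_
            rw [Finset.sum_comm]
        _ = _ := by
            rw [Finset.sum_comm]
            refine Finset.sum_congr rfl fun α _ => ?_
            rw [Finset.sum_comm]
            refine Finset.sum_congr rfl fun e _ => ?_
            rw [Finset.sum_eq_single (plant e.1 (z α) e.2)]
            · simp
            · intro S _ hS
              simp [Ne.symm hS]
            · simp
    rw [h1]
    refine Finset.sum_congr rfl fun α _ => ?_
    have h2 : ∀ e ∈ kept α,
        y (plant e.1 (z α) e.2) * (c α / (kept α).card * y (plant e.1 (z' α) e.2)) =
        c α / (kept α).card * ∏ j, ((x ε (z α j) : ℤ) : ℝ) * ((x ε (z' α j) : ℤ) : ℝ) := by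
      intro e _
      rw [← wordMonomial_plant_mul (x := fun v => ((x ε v : ℤ) : ℝ)) (fun v => hsq _) e.1 (z α)
        (z' α) e.2]
      ring
    rw [Finset.sum_congr rfl h2, Finset.sum_const, nsmul_eq_mul, ← mul_assoc,
      mul_div_cancel₀ _ (hcard0 α).ne']
  simp_rw [hquad]
  rw [← Finset.sum_fiberwise Finset.univ col]
  refine Finset.sum_congr rfl fun i _ => ?_
  rw [Finset.mul_sum]
  refine Finset.sum_congr rfl fun α hα => ?_
  rw [(Finset.mem_filter.1 hα).2]
end Kikuchi

/-! ### The Kikuchi bound at level `ℓ`, from counting hypotheses. -/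

section Level

/-- The number of letters per word used in the Kikuchi matrices. -/
noncomputable def wordLength (n q : ℕ) : ℕ := ⌈2 * levelParam n q⌉₊

variable {n q : ℕ}

lemma log_le_levelParam (hn : 2 ≤ n) (hq : 2 ≤ q) : Real.log n ≤ levelParam n q := by
  have hq' : (2 : ℝ) ≤ q := by exact_mod_cast hq
  have hn' : (1 : ℝ) ≤ n := by exact_mod_cast (by omega : 1 ≤ n)
  have h : (0 : ℝ) ≤ 1 - 2 / q := by
    rw [sub_nonneg, div_le_one (by linarith)]; exact hq'
  exact le_mul_of_one_le_left (Real.log_nonneg hn') (Real.one_le_rpow hn' h)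

lemma log_two_le_log (hn : 2 ≤ n) : (0.69 : ℝ) ≤ Real.log n := by
  have : Real.log 2 ≤ Real.log n := Real.log_le_log (by norm_num) (by exact_mod_cast hn)
  linarith [Real.log_two_gt_d9]

lemma one_le_wordLength (hn : 2 ≤ n) (hq : 2 ≤ q) : 1 ≤ wordLength n q := by
  have := log_le_levelParam hn hq
  have := log_two_le_log hn
  rw [wordLength, Nat.one_le_ceil_iff]
  linarith

lemma wordLength_le (hn : 2 ≤ n) (hq : 2 ≤ q) : (wordLength n q : ℝ) ≤ 4 * levelParam n q := by
  have := log_le_levelParam hn hq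
  have := log_two_le_log hn
  have := (Nat.ceil_lt_add_one (a := 2 * levelParam n q) (by linarith)).le
  rw [wordLength]
  linarith

/-- The factor 2 in `wordLength` serves here: `2 log n ≥ 1` already for `n = 2`. -/
lemma rpow_le_wordLength_div (hn : 2 ≤ n) :
    (n : ℝ) ^ (-(2 / q : ℝ)) ≤ (wordLength n q : ℝ) / n := by
  have hn' : (0 : ℝ) < n := by exact_mod_cast (by omega : 0 < n)
  rw [le_div_iff₀ hn']
  refine le_trans ?_ (Nat.le_ceil _)
  have h : (n : ℝ) ^ (-(2 / q : ℝ)) * n = (n : ℝ) ^ (1 - 2 / q : ℝ) := by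
    rw [← Real.rpow_add_one hn'.ne']
    congr 1; ring
  rw [h, levelParam]
  have := log_two_le_log hn
  have h0 : 0 < (n : ℝ) ^ (1 - 2 / q : ℝ) := Real.rpow_pos_of_pos hn' _
  nlinarith

/-- Expand the product over the sets `J` of coordinates where the agreement term is chosen. The
count pays `n^{-2|J|/q} ≤ p^{|J|}`, exactly replacing the missing factors of `p`, so each of the
`2^m` terms is at most `G n p^m`. -/
lemma sum_prod_le_of_count {ι : Type*} [Fintype ι] {m : ℕ} (s : Finset ι)
    (z : ι → Fin m → Fin n) (v : Fin m → Fin n) {p G : ℝ} (hn : 1 ≤ n) (hG : 0 ≤ G)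
    (hp : (n : ℝ) ^ (-(2 / q : ℝ)) ≤ p)
    (h : ∀ J : Finset (Fin m), ((s.filter fun α => ∀ j ∈ J, z α j = v j).card : ℝ) ≤
      G * (n : ℝ) ^ (1 - 2 * (J.card : ℝ) / q)) :
    ∑ α ∈ s, ∏ j, (p + if z α j = v j then 1 else 0) ≤ 2 ^ m * (G * n) * p ^ m := by
  have hn' : (0 : ℝ) < n := by exact_mod_cast hn
  have hp0 : 0 < p := lt_of_lt_of_le (Real.rpow_pos_of_pos hn' _) hp
  have h1 : ∀ α, ∏ j, (p + if z α j = v j then (1 : ℝ) else 0) =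
      ∑ J : Finset (Fin m), (if ∀ j ∈ J, z α j = v j then (1 : ℝ) else 0) * p ^ (m - J.card) := by
    intro α
    simp_rw [add_comm p]
    rw [Finset.prod_add, Finset.powerset_univ]
    refine Finset.sum_congr rfl fun J _ => ?_
    rw [Finset.prod_ite_zero, Finset.prod_const, Finset.prod_const,
      Finset.card_sdiff_of_subset (Finset.subset_univ _)]
    simp
  simp_rw [h1]
  rw [Finset.sum_comm]
  calc _ ≤ ∑ _J : Finset (Fin m), G * n * p ^ m := by
        refine Finset.sum_le_sum fun J _ => ?_
        have hJ : J.card ≤ m := by simpa using Finset.card_le_univ J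
        rw [← Finset.sum_mul, Finset.sum_boole]
        calc _ ≤ G * (n : ℝ) ^ (1 - 2 * (J.card : ℝ) / q) * p ^ (m - J.card) := by
              gcongr; exact h J
          _ = G * n * (((n : ℝ) ^ (-(2 / q : ℝ))) ^ J.card * p ^ (m - J.card)) := by
              have : (n : ℝ) ^ (1 - 2 * (J.card : ℝ) / q) =
                  n * ((n : ℝ) ^ (-(2 / q : ℝ))) ^ J.card := by
                rw [← Real.rpow_natCast, ← Real.rpow_mul hn'.le]
                nth_rewrite 2 [← Real.rpow_one (n : ℝ)]
                rw [← Real.rpow_add hn']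
                congr 1; ring
              rw [this]; ring
          _ ≤ G * n * (p ^ J.card * p ^ (m - J.card)) := by gcongr
          _ = _ := by rw [← pow_add, Nat.add_sub_cancel' hJ]
    _ = _ := by simp; ring

/-- The constant of the Kikuchi bound. -/
noncomputable def kikuchiConst (q : ℕ) : ℝ := (8 * 2 ^ q) ^ 2 * (54 * (4 * q + 3))

lemma kikuchiConst_pos (q : ℕ) : 0 < kikuchiConst q := by unfold kikuchiConst; positivity

variable {k m : ℕ} {ι : Type*} [Fintype ι]

/-- The Kikuchi bound at the level `levelParam n q`, from bounds on the number of monomials of one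
colour that share a given part of their halves with a given monomial. -/
lemma expect_kikuchi_le_of_count (hn : 2 ≤ n) (hq : 2 ≤ q) (hm : m ≤ q) (col : ι → Fin k)
    (z z' : ι → Fin m → Fin n) (c : ι → ℝ) (hc : ∀ α, |c α| ≤ 1) {G : ℝ} (hG : 0 < G)
    (hz : ∀ α₀, ∀ J : Finset (Fin m),
      ((Finset.univ.filter fun α => col α = col α₀ ∧ ∀ j ∈ J, z α j = z α₀ j).card : ℝ) ≤
        G * (n : ℝ) ^ (1 - 2 * (J.card : ℝ) / q))
    (hz' : ∀ α₀, ∀ J : Finset (Fin m),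
      ((Finset.univ.filter fun α => col α = col α₀ ∧ ∀ j ∈ J, z' α j = z' α₀ j).card : ℝ) ≤
        G * (n : ℝ) ^ (1 - 2 * (J.card : ℝ) / q))
    (x : (Fin k → ℤˣ) → Fin n → ℤˣ) :
    (𝔼 ε : Fin k → ℤˣ, ∑ α, ((ε (col α) : ℤ) : ℝ) *
      (c α * ∏ j, ((x ε (z α j) : ℤ) : ℝ) * ((x ε (z' α j) : ℤ) : ℝ))) ≤
      G * n * √(k * levelParam n q) * √(kikuchiConst q * Real.log n) := by
  have hn1 : 1 ≤ n := by omega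
  have hn' : (0 : ℝ) < n := by exact_mod_cast hn1
  have hl := one_le_wordLength hn hq
  have hl' : (0 : ℝ) < wordLength n q := by exact_mod_cast hl
  have hp := rpow_le_wordLength_div (q := q) hn
  have hlog := log_two_le_log hn
  have hlev := log_le_levelParam hn hq
  have hD : ∀ y : ι → Fin m → Fin n, (∀ α₀, ∀ J : Finset (Fin m),
      ((Finset.univ.filter fun α => col α = col α₀ ∧ ∀ j ∈ J, y α j = y α₀ j).card : ℝ) ≤
        G * (n : ℝ) ^ (1 - 2 * (J.card : ℝ) / q)) → ∀ α₀, ∑ α with col α = col α₀,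
      ∏ j, ((wordLength n q : ℝ) / n + if y α j = y α₀ j then 1 else 0) ≤
        2 ^ q * (G * n) * ((wordLength n q : ℝ) / n) ^ m := by
    intro y hy α₀
    refine (sum_prod_le_of_count _ y (y α₀) hn1 hG.le hp fun J => ?_).trans ?_
    · rw [Finset.filter_filter]
      exact hy α₀ J
    · gcongr
      norm_num
  refine (expect_kikuchi_le hn1 hl col z z' c hc (D := 2 ^ q * (G * n)) (by positivity)
    (hD z hz) (hD z' hz') x).trans ?_
  -- The summand 1 is absorbed by `3 ℓ log n`, since `ℓ` and `log n` are both at least `0.69`.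
  have h1 : (m : ℝ) * wordLength n q * Real.log n + 1 ≤
      (4 * q + 3) * (levelParam n q * Real.log n) := by
    have e1 : (m : ℝ) * wordLength n q * Real.log n ≤
        q * (4 * levelParam n q) * Real.log n := by
      gcongr
      exact wordLength_le hn hq
    nlinarith
  calc 8 * (2 ^ q * (G * n)) * √(54 * (k * (m * wordLength n q * Real.log n + 1)))
      ≤ 8 * (2 ^ q * (G * n)) *
          √(54 * (k * ((4 * q + 3) * (levelParam n q * Real.log n)))) := by gcongr
    _ = _ := by
        have e1 : √(kikuchiConst q * Real.log n) =
            8 * 2 ^ q * √(54 * (4 * q + 3) * Real.log n) := by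
          rw [kikuchiConst, mul_assoc, Real.sqrt_mul (by positivity), Real.sqrt_sq (by positivity)]
        have e2 : √(54 * (k * ((4 * q + 3) * (levelParam n q * Real.log n)))) =
            √(k * levelParam n q) * √(54 * (4 * q + 3) * Real.log n) := by
          have : 0 ≤ levelParam n q := by linarith
          rw [← Real.sqrt_mul (by positivity)]
          congr 1; ring
        rw [e1, e2]; ring
end Level

/-! ### Decoupling products of two colour signs. -/

section Decoupling
variable {k : ℕ}

lemma expect_sign (i : Fin k) : (𝔼 σ : Fin k → ℤˣ, ((σ i : ℤ) : ℝ)) = 0 := by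
  rw [Fintype.expect_eq_sum_div_card]
  have h : ∀ σ : Fin k → ℤˣ, ((σ i : ℤ) : ℝ) = ∏ j, if j = i then ((σ j : ℤ) : ℝ) else 1 := by
    intro σ; simp
  simp_rw [h]
  rw [sum_signs_prod fun j u => if j = i then ((u : ℤ) : ℝ) else 1,
    Finset.prod_eq_zero (Finset.mem_univ i), zero_div]
  simp

lemma expect_sign_mul {i i' : Fin k} (h : i ≠ i') :
    (𝔼 σ : Fin k → ℤˣ, ((σ i : ℤ) : ℝ) * ((σ i' : ℤ) : ℝ)) = 0 := by
  rw [Fintype.expect_eq_sum_div_card]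
  have h : ∀ σ : Fin k → ℤˣ, ((σ i : ℤ) : ℝ) * ((σ i' : ℤ) : ℝ) =
      ∏ j, (if j = i then ((σ j : ℤ) : ℝ) else 1) * (if j = i' then ((σ j : ℤ) : ℝ) else 1) := by
    intro σ; rw [Finset.prod_mul_distrib]; simp
  simp_rw [h]
  rw [sum_signs_prod fun j u =>
    (if j = i then ((u : ℤ) : ℝ) else 1) * (if j = i' then ((u : ℤ) : ℝ) else 1),
    Finset.prod_eq_zero (Finset.mem_univ i), zero_div]
  simp [*]

lemma abs_sign (u : ℤˣ) : |((u : ℤ) : ℝ)| = 1 := by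
  rcases Int.units_eq_one_or u with rfl | rfl <;> simp

/-- Random signs may be inserted at the coordinates in any set `{i | σ i = 1}`. -/
lemma expect_eq_expect_expect_mask (σ : Fin k → ℤˣ) (F : (Fin k → ℤˣ) → ℝ) :
    (𝔼 b, F b) = 𝔼 b : Fin k → ℤˣ, 𝔼 ε : Fin k → ℤˣ,
      F ((fun i => if σ i = 1 then ε i else 1) * b) := by
  rw [Finset.expect_comm]
  rw [← Fintype.expect_const (ι := Fin k → ℤˣ) (𝔼 b, F b)]
  refine Finset.expect_congr rfl fun ε _ => ?_
  exact (Fintype.expect_equiv (Equiv.mulLeft fun i => if σ i = 1 then ε i else 1) _ _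
    fun b => rfl).symm

variable {n m q : ℕ} {ι : Type*} [Fintype ι]

/-- The decoupled form of the Kikuchi bound: the sign of a monomial is a product of the signs of two
colours. -/
lemma expect_kikuchi_pair_le (hn : 2 ≤ n) (hq : 2 ≤ q) (hm : m ≤ q) (col col' : ι → Fin k)
    (hcol : ∀ α, col α ≠ col' α) (z z' : ι → Fin m → Fin n) {G : ℝ} (hG : 0 < G)
    (hz : ∀ α₀, ∀ J : Finset (Fin m),
      ((Finset.univ.filter fun α => col α = col α₀ ∧ ∀ j ∈ J, z α j = z α₀ j).card : ℝ) ≤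
        G * (n : ℝ) ^ (1 - 2 * (J.card : ℝ) / q))
    (hz' : ∀ α₀, ∀ J : Finset (Fin m),
      ((Finset.univ.filter fun α => col α = col α₀ ∧ ∀ j ∈ J, z' α j = z' α₀ j).card : ℝ) ≤
        G * (n : ℝ) ^ (1 - 2 * (J.card : ℝ) / q))
    (x : (Fin k → ℤˣ) → Fin n → ℤˣ) :
    (𝔼 b : Fin k → ℤˣ, ∑ α, ((b (col α) : ℤ) : ℝ) * ((b (col' α) : ℤ) : ℝ) *
      ∏ j, ((x b (z α j) : ℤ) : ℝ) * ((x b (z' α j) : ℤ) : ℝ)) ≤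
      4 * (G * n * √(k * levelParam n q) * √(kikuchiConst q * Real.log n)) := by
  classical
  set F : (Fin k → ℤˣ) → ι → ℝ := fun b α => ((b (col α) : ℤ) : ℝ) * ((b (col' α) : ℤ) : ℝ) *
      ∏ j, ((x b (z α j) : ℤ) : ℝ) * ((x b (z' α j) : ℤ) : ℝ) with hF
  -- For two distinct colours this weight has mean 1 over `σ`; it equals 4 when `σ` separates them
  -- as `(1, -1)` and vanishes otherwise. That is the source of the factor 4.
  have hone : ∀ α, (𝔼 σ : Fin k → ℤˣ, (1 + ((σ (col α) : ℤ) : ℝ)) *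
      (1 - ((σ (col' α) : ℤ) : ℝ))) = 1 := by
    intro α
    have h : ∀ σ : Fin k → ℤˣ, (1 + ((σ (col α) : ℤ) : ℝ)) * (1 - ((σ (col' α) : ℤ) : ℝ)) =
        1 + ((σ (col α) : ℤ) : ℝ) - (((σ (col' α) : ℤ) : ℝ) +
          ((σ (col α) : ℤ) : ℝ) * ((σ (col' α) : ℤ) : ℝ)) := fun σ => by ring
    simp_rw [h, Finset.expect_sub_distrib, Finset.expect_add_distrib, expect_sign,
      expect_sign_mul (hcol α)]
    rw [Fintype.expect_const]; ring
  have hsplit : (𝔼 b, ∑ α, F b α) = 𝔼 σ : Fin k → ℤˣ, 𝔼 b : Fin k → ℤˣ,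
      ∑ α, ((1 + ((σ (col α) : ℤ) : ℝ)) * (1 - ((σ (col' α) : ℤ) : ℝ))) * F b α := by
    rw [Finset.expect_comm]
    refine Finset.expect_congr rfl fun b _ => ?_
    rw [Finset.expect_sum_comm]
    refine Finset.sum_congr rfl fun α _ => ?_
    rw [← Finset.expect_mul, hone, one_mul]
  rw [hsplit]
  set X := 4 * (G * n * √(k * levelParam n q) * √(kikuchiConst q * Real.log n)) with hX
  refine (Finset.expect_le_expect (g := fun _ => X) fun σ _ => ?_).trans_eq
    (Fintype.expect_const _)
  have hrestrict : ∀ b : Fin k → ℤˣ,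
      ∑ α, ((1 + ((σ (col α) : ℤ) : ℝ)) * (1 - ((σ (col' α) : ℤ) : ℝ))) * F b α =
      4 * ∑ β : {α // σ (col α) = 1 ∧ σ (col' α) = -1}, F b β.1 := by
    intro b
    rw [Finset.mul_sum, ← Finset.sum_subtype (Finset.univ.filter fun α => σ (col α) = 1 ∧
      σ (col' α) = -1) (by simp) fun α => 4 * F b α, Finset.sum_filter]
    refine Finset.sum_congr rfl fun α _ => ?_
    rcases Int.units_eq_one_or (σ (col α)) with h1 | h1 <;>
    rcases Int.units_eq_one_or (σ (col' α)) with h2 | h2 <;>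
    simp [h1, h2]
    norm_num
  simp_rw [hrestrict]
  rw [← Finset.mul_expect, hX]
  refine mul_le_mul_of_nonneg_left ?_ (by norm_num)
  -- Fresh signs `ε` enter only where `σ = 1`. With `b` frozen, the first colour supplies the random
  -- sign and the rest is a coefficient of modulus 1; the maximiser may depend on `ε`.
  rw [expect_eq_expect_expect_mask σ]
  refine (Finset.expect_le_expect fun b _ => ?_).trans_eq (Fintype.expect_const _)
  have hcount : ∀ y : ι → Fin m → Fin n, (∀ α₀, ∀ J : Finset (Fin m),
      ((Finset.univ.filter fun α => col α = col α₀ ∧ ∀ j ∈ J, y α j = y α₀ j).card : ℝ) ≤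
        G * (n : ℝ) ^ (1 - 2 * (J.card : ℝ) / q)) →
      ∀ β₀ : {α // σ (col α) = 1 ∧ σ (col' α) = -1}, ∀ J : Finset (Fin m),
      ((Finset.univ.filter fun β : {α // σ (col α) = 1 ∧ σ (col' α) = -1} =>
        col β.1 = col β₀.1 ∧ ∀ j ∈ J, y β.1 j = y β₀.1 j).card : ℝ) ≤
        G * (n : ℝ) ^ (1 - 2 * (J.card : ℝ) / q) := by
    intro y hy β₀ J
    refine le_trans (Nat.cast_le.2 ?_) (hy β₀.1 J)
    refine Finset.card_le_card_of_injOn Subtype.val ?_ Subtype.val_injective.injOn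
    intro β hβ
    simpa using hβ
  refine le_trans (le_of_eq ?_) (expect_kikuchi_le_of_count hn hq hm
    (fun β : {α // σ (col α) = 1 ∧ σ (col' α) = -1} => col β.1) (fun β => z β.1) (fun β => z' β.1)
    (fun β => ((b (col β.1) : ℤ) : ℝ) * ((b (col' β.1) : ℤ) : ℝ))
    (fun β => by simp [abs_mul, abs_sign]) hG (hcount z hz) (hcount z' hz')
    (fun ε => x ((fun i => if σ i = 1 then ε i else 1) * b)))
  refine Finset.expect_congr rfl fun ε _ => Finset.sum_congr rfl fun β _ => ?_
  simp only [hF, Pi.mul_apply, β.2.1, β.2.2, if_true]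
  rw [if_neg (by decide)]
  push_cast
  ring
end Decoupling

/-! ### Codegrees, matchings and the case of even uniformity. -/

section Hypergraph
variable {n : ℕ}

lemma codegree_le_maxCodegree {ι : Type*} [Fintype ι] (e : ι → Finset (Fin n))
    (Q : Finset (Fin n)) : codegree e Q ≤ maxCodegree e Q.card :=
  Finset.le_sup (f := codegree e) (by simp)

lemma maxCodegree_antitone {ι : Type*} [Fintype ι] (e : ι → Finset (Fin n)) :
    Antitone (maxCodegree e) := by
  refine antitone_nat_of_succ_le fun r => Finset.sup_le fun Q hQ => ?_
  have hQc : Q.card = r + 1 := by simpa using hQ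
  obtain ⟨Q', hQ', hc⟩ := Finset.exists_subset_card_eq (show r ≤ Q.card by omega)
  rw [← hc]
  refine le_trans (Finset.card_le_card ?_) (codegree_le_maxCodegree e Q')
  intro a ha
  simp only [Finset.mem_filter, Finset.mem_univ, true_and] at ha ⊢
  exact hQ'.trans ha

lemma one_le_maxCodegree {ι : Type*} [Fintype ι] (e : ι → Finset (Fin n)) (a : ι) {t : ℕ}
    (ht : t ≤ (e a).card) : 1 ≤ maxCodegree e t := by
  refine le_trans ?_ (maxCodegree_antitone e ht)
  refine le_trans ?_ (codegree_le_maxCodegree e (e a))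
  exact Finset.card_pos.2 ⟨a, by simp⟩

variable {k q : ℕ} {H : Fin k → Finset (Finset (Fin n))}

lemma card_unionEdges (H : Fin k → Finset (Finset (Fin n))) :
    Fintype.card (Σ i : Fin k, {C : Finset (Fin n) // C ∈ H i}) = numEdges H := by
  simp [numEdges]

/-- In a union of matchings, a hyperedge is determined by its colour and one of its vertices. -/
lemma edge_eq_of_mem (hH : ∀ i, IsUniformMatching q (H i))
    {a a' : Σ i : Fin k, {C : Finset (Fin n) // C ∈ H i}} (hcol : a.1 = a'.1) {v : Fin n}
    (hv : v ∈ unionEdges H a) (hv' : v ∈ unionEdges H a') : a = a' := by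
  obtain ⟨i, C, hC⟩ := a
  obtain ⟨i', C', hC'⟩ := a'
  obtain rfl : i = i' := hcol
  by_cases h : C = C'
  · subst h; rfl
  · exact absurd ((hH i).2 C hC C' hC' h) (Finset.not_disjoint_iff.2 ⟨v, hv, hv'⟩)

lemma card_colour_le (hH : ∀ i, IsUniformMatching q (H i)) (hq : 1 ≤ q) (i : Fin k) :
    (Finset.univ.filter fun a : Σ i : Fin k, {C : Finset (Fin n) // C ∈ H i} => a.1 = i).card
      ≤ n := by
  have hne : ∀ a : Σ i : Fin k, {C : Finset (Fin n) // C ∈ H i}, (unionEdges H a).Nonempty := by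
    intro a
    rw [← Finset.card_pos, show (unionEdges H a).card = q from (hH a.1).1 _ a.2.2]
    exact hq
  choose v hv using hne
  have := Finset.card_le_card_of_injOn (t := (Finset.univ : Finset (Fin n)))
    (s := Finset.univ.filter fun a : Σ i : Fin k, {C : Finset (Fin n) // C ∈ H i} => a.1 = i) v
    (fun _ _ => by simp) (by
      intro a ha a' ha' h
      simp only [Finset.coe_filter, Finset.mem_univ, true_and, Set.mem_ofPred_eq] at ha ha'
      exact edge_eq_of_mem hH (ha.trans ha'.symm) (hv a) (h ▸ hv a'))
  simpa using this

lemma xorPoly_eq_sum (H : Fin k → Finset (Finset (Fin n))) (b : Fin k → ℤˣ) (x : Fin n → ℤˣ) :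
    xorPoly H b x = ∑ a : Σ i : Fin k, {C : Finset (Fin n) // C ∈ H i},
      ((b a.1 : ℤ) : ℝ) * ∏ v ∈ unionEdges H a, ((x v : ℤ) : ℝ) := by
  rw [xorPoly, Fintype.sum_sigma]
  refine Finset.sum_congr rfl fun i _ => ?_
  rw [Finset.mul_sum]
  exact (Finset.sum_coe_sort (H i)
    (fun C => ((b i : ℤ) : ℝ) * ∏ v ∈ C, ((x v : ℤ) : ℝ))).symm

lemma exists_xorVal_eq (H : Fin k → Finset (Finset (Fin n))) :
    ∃ x : (Fin k → ℤˣ) → Fin n → ℤˣ, ∀ b, xorVal H b = xorPoly H b (x b) := by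
  have : ∀ b, ∃ x, xorVal H b = xorPoly H b x := fun b => by
    obtain ⟨x, _, hx⟩ := Finset.exists_mem_eq_sup' (Finset.univ_nonempty) (xorPoly H b)
    exact ⟨x, hx⟩
  exact ⟨fun b => (this b).choose, fun b => (this b).choose_spec⟩

lemma abs_xorPoly_le (H : Fin k → Finset (Finset (Fin n))) (b : Fin k → ℤˣ) (x : Fin n → ℤˣ) :
    |xorPoly H b x| ≤ numEdges H := by
  rw [xorPoly_eq_sum, ← card_unionEdges]
  refine (Finset.abs_sum_le_sum_abs _ _).trans ?_
  simp [abs_mul, Finset.abs_prod, abs_sign]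

/-- All monomials are nonconstant, so the polynomial has mean zero over the cube and its maximum
cannot be negative. -/
lemma xorVal_nonneg (hH : ∀ i, IsUniformMatching q (H i)) (hq : 1 ≤ q) (b : Fin k → ℤˣ) :
    0 ≤ xorVal H b := by
  have hsum : ∑ x : Fin n → ℤˣ, xorPoly H b x = 0 := by
    simp_rw [xorPoly_eq_sum]
    rw [Finset.sum_comm]
    refine Finset.sum_eq_zero fun a _ => ?_
    rw [← Finset.mul_sum]
    have hc : (unionEdges H a).card = q := (hH a.1).1 _ a.2.2
    obtain ⟨v, hv⟩ := Finset.card_pos.1 (by omega : 0 < (unionEdges H a).card)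
    have h : ∀ x : Fin n → ℤˣ, ∏ v ∈ unionEdges H a, ((x v : ℤ) : ℝ) =
        ∏ v, if v ∈ unionEdges H a then ((x v : ℤ) : ℝ) else 1 := by
      intro x; rw [Finset.prod_ite_mem, Finset.univ_inter]
    simp_rw [h]
    rw [sum_signs_prod fun v u => if v ∈ unionEdges H a then ((u : ℤ) : ℝ) else 1,
      Finset.prod_eq_zero (Finset.mem_univ v), mul_zero]
    simp [hv]
  by_contra! hneg
  have : ∑ x : Fin n → ℤˣ, xorPoly H b x < 0 := by
    refine Finset.sum_neg (fun x _ => lt_of_le_of_lt ?_ hneg) Finset.univ_nonempty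
    exact Finset.le_sup' (xorPoly H b) (Finset.mem_univ x)
  exact this.ne hsum

/-- For uniformity `m + m`, the Kikuchi bound applies to the hyperedges themselves. -/
lemma expect_xorVal_le_of_even {m : ℕ} (hn : 2 ≤ n) (hm : 1 ≤ m)
    (hH : ∀ i, IsUniformMatching (m + m) (H i)) :
    (𝔼 b : Fin k → ℤˣ, xorVal H b) ≤
      n * √(k * levelParam n (m + m)) * √(kikuchiConst (m + m) * Real.log n) := by
  obtain ⟨x, hx⟩ := exists_xorVal_eq H
  have hcard : ∀ a, (unionEdges H a).card = m + m := fun a => (hH a.1).1 _ a.2.2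
  have hn' : (1 : ℝ) ≤ n := by exact_mod_cast (by omega : 1 ≤ n)
  have hm' : (0 : ℝ) < m := by exact_mod_cast hm
  set emb : ∀ a, Fin (m + m) → Fin n := fun a => (unionEdges H a).orderEmbOfFin (hcard a) with hemb
  have hmem : ∀ a j, emb a j ∈ unionEdges H a := fun a j => Finset.orderEmbOfFin_mem _ (hcard a) j
  have hcount : ∀ g : Fin m → Fin (m + m),
      ∀ a₀ : Σ i : Fin k, {C : Finset (Fin n) // C ∈ H i}, ∀ J : Finset (Fin m),
      ((Finset.univ.filter fun a : Σ i : Fin k, {C : Finset (Fin n) // C ∈ H i} =>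
        a.1 = a₀.1 ∧ ∀ j ∈ J, emb a (g j) = emb a₀ (g j)).card : ℝ) ≤
        1 * (n : ℝ) ^ (1 - 2 * (J.card : ℝ) / (m + m : ℕ)) := by
    intro g a₀ J
    rw [one_mul]
    rcases J.eq_empty_or_nonempty with rfl | ⟨j, hj⟩
    · have := card_colour_le hH (by omega) a₀.1
      simpa using this
    -- One shared vertex and the colour determine the hyperedge, and the exponent is nonnegative
    -- because `|J| ≤ m` is half the uniformity.
    · have hJ : (J.card : ℝ) ≤ m := by exact_mod_cast (by simpa using Finset.card_le_univ J)
      calc _ ≤ (1 : ℝ) := by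
            have : (Finset.univ.filter fun a : Σ i : Fin k, {C : Finset (Fin n) // C ∈ H i} =>
                a.1 = a₀.1 ∧ ∀ j ∈ J, emb a (g j) = emb a₀ (g j)) ⊆ {a₀} := by
              intro a ha
              simp only [Finset.mem_filter, Finset.mem_univ, true_and] at ha
              rw [Finset.mem_singleton]
              exact edge_eq_of_mem hH ha.1 (hmem a (g j)) (ha.2 j hj ▸ hmem a₀ (g j))
            exact_mod_cast (Finset.card_le_card this).trans (by simp)
        _ ≤ _ := by
            refine Real.one_le_rpow hn' ?_
            rw [sub_nonneg, div_le_one (by push_cast; linarith)]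
            push_cast; linarith
  have h := expect_kikuchi_le_of_count (k := k) hn (by omega : 2 ≤ m + m) (by omega : m ≤ m + m)
    (fun a : Σ i : Fin k, {C : Finset (Fin n) // C ∈ H i} => a.1)
    (fun a j => emb a (Fin.castAdd m j)) (fun a j => emb a (Fin.natAdd m j)) (fun _ => 1) (by simp)
    one_pos (hcount _) (hcount _) x
  rw [one_mul] at h
  refine le_trans (le_of_eq ?_) h
  refine Finset.expect_congr rfl fun b _ => ?_
  rw [hx, xorPoly_eq_sum]
  refine Finset.sum_congr rfl fun a _ => ?_
  rw [one_mul, Finset.prod_mul_distrib,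
    ← Fin.prod_univ_add (f := fun j => ((x b (emb a j) : ℤ) : ℝ)),
    ← Finset.prod_coe_sort,
    ← ((unionEdges H a).orderIsoOfFin (hcard a)).toEquiv.prod_comp]
  rfl

lemma expect_xorVal_sq_le_of_even {m : ℕ} (hn : 2 ≤ n) (hm : 1 ≤ m)
    (hH : ∀ i, IsUniformMatching (m + m) (H i)) :
    (𝔼 b : Fin k → ℤˣ, xorVal H b ^ 2) ≤ numEdges H *
      (n * √(k * levelParam n (m + m)) * √(kikuchiConst (m + m) * Real.log n)) := by
  refine le_trans ?_ (mul_le_mul_of_nonneg_left (expect_xorVal_le_of_even hn hm hH)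
    (Nat.cast_nonneg _))
  rw [Finset.mul_expect]
  refine Finset.expect_le_expect fun b _ => ?_
  rw [sq]
  refine mul_le_mul_of_nonneg_right ?_ (xorVal_nonneg hH (by omega) b)
  obtain ⟨x, hx⟩ := exists_xorVal_eq H
  rw [hx]
  exact (le_abs_self _).trans (abs_xorPoly_le H b _)
end Hypergraph

/-! ### Consequences of the good-index inequalities. -/

section GoodIndex
variable {n q t : ℕ} {d : ℕ → ℕ}

lemma IsGoodIndex.le_small (hg : IsGoodIndex n q d t) (hdt : 0 < d t) {b m : ℕ} (hb : 1 ≤ b)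
    (hbm : b ≤ (m + 1) / 2) (hm : m ≤ q - t) :
    (d b : ℝ) ≤ d t * (n : ℝ) ^ (1 - 2 * (b : ℝ) / q) := by
  have h := hg.small b hb (by omega)
  rwa [div_le_iff₀' (by exact_mod_cast hdt)] at h

/-- Here `a` and `b` count the prescribed vertices in `C` and in `C' \ C`. The slack in the exponent
covers `a` up to half of `q - t`, and the parity indicator accounts for rounding. -/
lemma IsGoodIndex.le_large (hg : IsGoodIndex n q d t) (hd : Antitone d) (hn : 1 ≤ n) (hq : Odd q)
    (htq : t ≤ q) (hdt : 0 < d t) {a b m : ℕ} (ham : a ≤ (m + 1) / 2)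
    (hbm : b ≤ (m + 1) / 2) (hab : a + b ≤ m) (hm : m ≤ q - t) :
    (d (t + b) : ℝ) ≤ d t * (n : ℝ) ^ (1 - 2 * ((a + b : ℕ) : ℝ) / q) := by
  have hn' : (1 : ℝ) ≤ n := by exact_mod_cast hn
  have hq0 : (0 : ℝ) < q := by exact_mod_cast hq.pos
  have key : ∀ r : ℕ, t ≤ r → r ≤ (q + t) / 2 →
      2 * a + 2 * b + 3 * t ≤ q + 2 * r + (if Even t then 1 else 0) →
      (d r : ℝ) ≤ d t * (n : ℝ) ^ (1 - 2 * ((a + b : ℕ) : ℝ) / q) := by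
    intro r h1 h2 h3
    have h := hg.large r h1 h2
    rw [div_le_iff₀' (by exact_mod_cast hdt)] at h
    refine h.trans ?_
    refine mul_le_mul_of_nonneg_left (Real.rpow_le_rpow_of_exponent_le hn' ?_) (Nat.cast_nonneg _)
    have h3' : 2 * (a : ℝ) + 2 * b + 3 * t ≤ q + 2 * r + (if Even t then (1 : ℝ) else 0) := by
      exact_mod_cast h3
    have e1 : -(2 / (q : ℝ)) * ((r : ℝ) - t) + 1 / (q : ℝ) * ((t : ℝ) - if Even t then 1 else 0) =
        (-2 * (r - t) + (t - if Even t then 1 else 0)) / q := by field_simp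
    have e2 : 1 - 2 * ((a + b : ℕ) : ℝ) / q = (q - 2 * (a + b)) / q := by
      push_cast; field_simp
    rw [e1, e2]
    gcongr
    linarith
  have hq2 := Nat.odd_iff.1 hq
  by_cases hb : t + b ≤ (q + t) / 2
  · refine key (t + b) (by omega) hb ?_
    by_cases het : Even t
    · rw [if_pos het]; omega
    · have ht2 := Nat.odd_iff.1 (Nat.not_even_iff_odd.1 het)
      rw [if_neg het]; omega
  -- Only `t` even and `b = (q - t + 1) / 2` reach this case, one step outside the permitted range
  -- of `r`. Monotonicity allows `r = t + b - 1`; the loss is affordable because `a + b ≤ m` forces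
  -- `a` to be smaller.
  · have hle : (d (t + b) : ℝ) ≤ d (t + b - 1) := by exact_mod_cast hd (by omega)
    refine hle.trans (key (t + b - 1) (by omega) (by omega) ?_)
    by_cases het : Even t
    · have ht2 := Nat.even_iff.1 het
      rw [if_pos het]; omega
    · have ht2 := Nat.odd_iff.1 (Nat.not_even_iff_odd.1 het)
      rw [if_neg het]; omega
end GoodIndex

/-! ### Pairs of hyperedges in a common part. -/

section Pairs
variable {n k q t p : ℕ} {H : Fin k → Finset (Finset (Fin n))}

/-- Ordered pairs of distinct hyperedges in a common part, the first of which has exactly `m`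
vertices outside the second. -/
abbrev OverlapPair (H : Fin k → Finset (Finset (Fin n)))
    (part : (Σ i : Fin k, {C : Finset (Fin n) // C ∈ H i}) → Fin p) (m : ℕ) : Type :=
  {π : (Σ i : Fin k, {C : Finset (Fin n) // C ∈ H i}) ×
      (Σ i : Fin k, {C : Finset (Fin n) // C ∈ H i}) //
    (part π.1 = part π.2 ∧ π.1 ≠ π.2) ∧ (unionEdges H π.1 \ unionEdges H π.2).card = m}

variable {part : (Σ i : Fin k, {C : Finset (Fin n) // C ∈ H i}) → Fin p}
  {Q : Fin p → Finset (Fin n)}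

lemma edge_eq_of_part_eq (hH : ∀ i, IsUniformMatching q (H i)) (ht : 1 ≤ t)
    (hQc : ∀ θ, (Q θ).card = t) (hQ : ∀ a, Q (part a) ⊆ unionEdges H a)
    {a a' : Σ i : Fin k, {C : Finset (Fin n) // C ∈ H i}} (hcol : a.1 = a'.1)
    (hpart : part a = part a') : a = a' := by
  obtain ⟨v, hv⟩ := Finset.card_pos.1 (by rw [hQc]; omega : 0 < (Q (part a)).card)
  exact edge_eq_of_mem hH hcol (hQ a hv) (hQ a' (hpart ▸ hv))

lemma card_sdiff_add_le (hH : ∀ i, IsUniformMatching q (H i))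
    (hQc : ∀ θ, (Q θ).card = t) (hQ : ∀ a, Q (part a) ⊆ unionEdges H a)
    {a a' : Σ i : Fin k, {C : Finset (Fin n) // C ∈ H i}} (hpart : part a = part a') :
    (unionEdges H a \ unionEdges H a').card + t ≤ q := by
  have hc : (unionEdges H a).card = q := (hH a.1).1 _ a.2.2
  have h := Finset.card_sdiff_add_card_inter (unionEdges H a) (unionEdges H a')
  have hsub : Q (part a) ⊆ unionEdges H a ∩ unionEdges H a' :=
    Finset.subset_inter (hQ a) (hpart ▸ hQ a')
  have := Finset.card_le_card hsub
  rw [hQc] at this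
  omega

variable {m : ℕ} (y : OverlapPair H part m → Fin m → Fin n) (side : Fin m → Prop)
  [DecidablePred side]

/-- The tuple `y π` is one half of the monomial, and `side` marks its letters from the first
hyperedge. One such letter and the colour determine `π.1.1`, hence the part. The second hyperedge
must then contain `Q` of that part together with the prescribed vertices off the first hyperedge,
which are disjoint from `Q`. -/
lemma card_pairs_le_of_side (hH : ∀ i, IsUniformMatching q (H i))
    (hQc : ∀ θ, (Q θ).card = t) (hQ : ∀ a, Q (part a) ⊆ unionEdges H a)
    (hinj : ∀ π, Function.Injective (y π))
    (h1 : ∀ π j, side j → y π j ∈ unionEdges H π.1.1)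
    (h2 : ∀ π j, ¬ side j → y π j ∈ unionEdges H π.1.2 \ unionEdges H π.1.1)
    (π₀ : OverlapPair H part m) (J : Finset (Fin m)) (hJ : ∃ j ∈ J, side j) :
    (Finset.univ.filter fun π : OverlapPair H part m =>
      π.1.1.1 = π₀.1.1.1 ∧ ∀ j ∈ J, y π j = y π₀ j).card ≤
      maxCodegree (unionEdges H) (t + (J.filter fun j => ¬ side j).card) := by
  classical
  obtain ⟨j₀, hj₀, hside⟩ := hJ
  set S := Q (part π₀.1.1) ∪ (J.filter fun j => ¬ side j).image (y π₀) with hS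
  have hScard : S.card = t + (J.filter fun j => ¬ side j).card := by
    rw [hS, Finset.card_union_of_disjoint, hQc, Finset.card_image_of_injective _ (hinj π₀)]
    rw [Finset.disjoint_left]
    intro v hv hv'
    obtain ⟨j, hj, rfl⟩ := Finset.mem_image.1 hv'
    exact (Finset.mem_sdiff.1 (h2 π₀ j (Finset.mem_filter.1 hj).2)).2 (hQ _ hv)
  rw [← hScard]
  refine le_trans ?_ (codegree_le_maxCodegree (unionEdges H) S)
  have hfst : ∀ π : OverlapPair H part m, (π.1.1.1 = π₀.1.1.1 ∧ ∀ j ∈ J, y π j = y π₀ j) →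
      π.1.1 = π₀.1.1 := fun π hπ =>
    edge_eq_of_mem hH hπ.1 (h1 π j₀ hside) (hπ.2 j₀ hj₀ ▸ h1 π₀ j₀ hside)
  refine Finset.card_le_card_of_injOn (fun π => π.1.2) ?_ ?_
  · intro π hπ
    have hπ' := (Finset.mem_filter.1 hπ).2
    refine Finset.mem_coe.2 (Finset.mem_filter.2 ⟨Finset.mem_univ _, ?_⟩)
    refine Finset.union_subset ?_ fun v hv => ?_
    · rw [← hfst π hπ', π.2.1.1]
      exact hQ _
    · obtain ⟨j, hj, rfl⟩ := Finset.mem_image.1 hv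
      obtain ⟨hjJ, hjs⟩ := Finset.mem_filter.1 hj
      rw [← hπ'.2 j hjJ]
      exact (Finset.mem_sdiff.1 (h2 π j hjs)).1
  · intro π hπ π' hπ' h
    exact Subtype.ext (Prod.ext ((hfst π (Finset.mem_filter.1 hπ).2).trans
      (hfst π' (Finset.mem_filter.1 hπ').2).symm) h)

omit [DecidablePred side] in
-- All prescribed vertices lie in the second hyperedge. Once chosen, it fixes the part, and a part
-- contains at most one hyperedge of each colour, so the first one is determined too.
lemma card_pairs_le_of_not_side (hH : ∀ i, IsUniformMatching q (H i)) (ht : 1 ≤ t)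
    (hQc : ∀ θ, (Q θ).card = t) (hQ : ∀ a, Q (part a) ⊆ unionEdges H a)
    (hinj : ∀ π, Function.Injective (y π))
    (h2 : ∀ π j, ¬ side j → y π j ∈ unionEdges H π.1.2)
    (π₀ : OverlapPair H part m) (J : Finset (Fin m)) (hJ : ∀ j ∈ J, ¬ side j) :
    (Finset.univ.filter fun π : OverlapPair H part m =>
      π.1.1.1 = π₀.1.1.1 ∧ ∀ j ∈ J, y π j = y π₀ j).card ≤
      maxCodegree (unionEdges H) J.card := by
  classical
  rw [← Finset.card_image_of_injective J (hinj π₀)]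
  refine le_trans ?_ (codegree_le_maxCodegree (unionEdges H) (J.image (y π₀)))
  refine Finset.card_le_card_of_injOn (fun π => π.1.2) ?_ ?_
  · intro π hπ
    have hπ' := (Finset.mem_filter.1 hπ).2
    refine Finset.mem_coe.2 (Finset.mem_filter.2 ⟨Finset.mem_univ _, fun v hv => ?_⟩)
    obtain ⟨j, hj, rfl⟩ := Finset.mem_image.1 hv
    rw [← hπ'.2 j hj]
    exact h2 π j (hJ j hj)
  · intro π hπ π' hπ' h
    have e1 := (Finset.mem_filter.1 hπ).2.1
    have e2 := (Finset.mem_filter.1 hπ').2.1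
    have h' : π.1.2 = π'.1.2 := h
    refine Subtype.ext (Prod.ext (edge_eq_of_part_eq hH ht hQc hQ (e1.trans e2.symm) ?_) h')
    rw [π.2.1.1, π'.2.1.1, h']

/-- A matching has at most `n` hyperedges to serve as the first, and the part of each offers at most
`d_t` partners. -/
lemma card_pairs_le (hH : ∀ i, IsUniformMatching q (H i)) (hq : 1 ≤ q)
    (hsize : ∀ θ, (Finset.univ.filter fun a => part a = θ).card ≤ maxCodegree (unionEdges H) t)
    (i : Fin k) :
    (Finset.univ.filter fun π : OverlapPair H part m => π.1.1.1 = i).card ≤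
      maxCodegree (unionEdges H) t * n := by
  classical
  refine (Finset.card_le_mul_card_image_of_maps_to (f := fun π : OverlapPair H part m => π.1.1)
    (t := Finset.univ.filter fun a => a.1 = i) (fun π hπ => ?_)
    (maxCodegree (unionEdges H) t) fun a _ => ?_).trans
    (Nat.mul_le_mul_left _ (card_colour_le hH hq i))
  · simpa using hπ
  · refine le_trans ?_ (hsize (part a))
    refine Finset.card_le_card_of_injOn (fun π => π.1.2) ?_ ?_
    · intro π hπ
      have : π.1.1 = a := (Finset.mem_filter.1 hπ).2
      refine Finset.mem_coe.2 (Finset.mem_filter.2 ⟨Finset.mem_univ _, ?_⟩)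
      rw [← π.2.1.1, this]
    · intro π hπ π' hπ' h
      exact Subtype.ext (Prod.ext ((Finset.mem_filter.1 hπ).2.trans
        (Finset.mem_filter.1 hπ').2.symm) h)

lemma card_pairs_le_rpow (hH : ∀ i, IsUniformMatching q (H i)) (ht : 1 ≤ t) (htq : t ≤ q)
    (hq : Odd q) (hn : 1 ≤ n)
    (hQc : ∀ θ, (Q θ).card = t) (hQ : ∀ a, Q (part a) ⊆ unionEdges H a)
    (hsize : ∀ θ, (Finset.univ.filter fun a => part a = θ).card ≤ maxCodegree (unionEdges H) t)
    (hg : IsGoodIndex n q (maxCodegree (unionEdges H)) t)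
    (hdt : 0 < maxCodegree (unionEdges H) t) (hm : m ≤ q - t)
    (hs1 : (Finset.univ.filter side).card ≤ (m + 1) / 2)
    (hs2 : (Finset.univ.filter fun j => ¬ side j).card ≤ (m + 1) / 2)
    (hinj : ∀ π, Function.Injective (y π))
    (h1 : ∀ π j, side j → y π j ∈ unionEdges H π.1.1)
    (h2 : ∀ π j, ¬ side j → y π j ∈ unionEdges H π.1.2 \ unionEdges H π.1.1)
    (π₀ : OverlapPair H part m) (J : Finset (Fin m)) :
    ((Finset.univ.filter fun π : OverlapPair H part m =>
      π.1.1.1 = π₀.1.1.1 ∧ ∀ j ∈ J, y π j = y π₀ j).card : ℝ) ≤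
      maxCodegree (unionEdges H) t * (n : ℝ) ^ (1 - 2 * (J.card : ℝ) / q) := by
  have hJ1 : (J.filter side).card ≤ (m + 1) / 2 :=
    (Finset.card_le_card (Finset.filter_subset_filter _ (Finset.subset_univ J))).trans hs1
  have hJ2 : (J.filter fun j => ¬ side j).card ≤ (m + 1) / 2 :=
    (Finset.card_le_card (Finset.filter_subset_filter _ (Finset.subset_univ J))).trans hs2
  have hsplit := Finset.card_filter_add_card_filter_not (s := J) side
  have hJm : J.card ≤ m := by simpa using Finset.card_le_univ J
  by_cases hex : ∃ j ∈ J, side j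
  · refine (Nat.cast_le.2 (card_pairs_le_of_side y side hH hQc hQ hinj h1 h2 π₀ J hex)).trans ?_
    rw [← hsplit]
    exact hg.le_large (maxCodegree_antitone _) hn hq htq hdt hJ1 hJ2 (by omega) hm
  · push Not at hex
    rcases J.eq_empty_or_nonempty with rfl | hne
    · have := card_pairs_le (m := m) hH hq.pos hsize π₀.1.1.1
      simp only [Finset.notMem_empty, IsEmpty.forall_iff, implies_true, and_true,
        Finset.card_empty, Nat.cast_zero, mul_zero, zero_div, sub_zero, Real.rpow_one]
      exact_mod_cast this
    · refine (Nat.cast_le.2 (card_pairs_le_of_not_side y side hH ht hQc hQ hinj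
        (fun π j hj => (Finset.mem_sdiff.1 (h2 π j hj)).1) π₀ J hex)).trans ?_
      rw [Finset.filter_true_of_mem hex] at hJ2
      exact hg.le_small hdt (Finset.card_pos.2 hne) hJ2 hm

lemma prod_mul_prod_eq_sdiff {x : Fin n → ℝ} (hx : ∀ v, x v * x v = 1) (C C' : Finset (Fin n)) :
    (∏ v ∈ C, x v) * ∏ v ∈ C', x v = (∏ v ∈ C \ C', x v) * ∏ v ∈ C' \ C, x v := by
  have h1 : (∏ v ∈ C ∩ C', x v) * ∏ v ∈ C \ C', x v = ∏ v ∈ C, x v :=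
    Finset.prod_inter_mul_prod_sdiff C C' x
  have h2 : (∏ v ∈ C' ∩ C, x v) * ∏ v ∈ C' \ C, x v = ∏ v ∈ C', x v :=
    Finset.prod_inter_mul_prod_sdiff C' C x
  have h3 : (∏ v ∈ C ∩ C', x v) * ∏ v ∈ C ∩ C', x v = 1 := by
    rw [← Finset.prod_mul_distrib]
    exact Finset.prod_eq_one fun v _ => hx v
  rw [← h1, ← h2, Finset.inter_comm C' C]
  linear_combination ((∏ v ∈ C \ C', x v) * ∏ v ∈ C' \ C, x v) * h3

lemma units_cast_mul_self (u : ℤˣ) : ((u : ℤ) : ℝ) * ((u : ℤ) : ℝ) = 1 := by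
  rcases Int.units_eq_one_or u with rfl | rfl <;> simp

lemma prod_eq_prod_orderEmbOfFin {M : Type*} [CommMonoid M] (C : Finset (Fin n)) (h : C.card = m)
    (f : Fin n → M) : ∏ v ∈ C, f v = ∏ j, f (C.orderEmbOfFin h j) := by
  rw [← Finset.prod_coe_sort, ← (C.orderIsoOfFin h).toEquiv.prod_comp]
  rfl

/-- The Kikuchi bound for the pairs of hyperedges with `m` vertices outside each other. -/
lemma expect_pairs_le (hH : ∀ i, IsUniformMatching q (H i)) (ht : 1 ≤ t) (htq : t ≤ q)
    (hq : Odd q)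
    (hQc : ∀ θ, (Q θ).card = t) (hQ : ∀ a, Q (part a) ⊆ unionEdges H a)
    (hsize : ∀ θ, (Finset.univ.filter fun a => part a = θ).card ≤ maxCodegree (unionEdges H) t)
    (hg : IsGoodIndex n q (maxCodegree (unionEdges H)) t)
    (hdt : 0 < maxCodegree (unionEdges H) t) (m : ℕ) (x : (Fin k → ℤˣ) → Fin n → ℤˣ) :
    (𝔼 b : Fin k → ℤˣ, ∑ π : OverlapPair H part m,
      ((b π.1.1.1 : ℤ) : ℝ) * ((b π.1.2.1 : ℤ) : ℝ) *
        ((∏ v ∈ unionEdges H π.1.1, ((x b v : ℤ) : ℝ)) *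
          ∏ v ∈ unionEdges H π.1.2, ((x b v : ℤ) : ℝ))) ≤
      4 * (maxCodegree (unionEdges H) t * n * √(k * levelParam n q) *
        √(kikuchiConst q * Real.log n)) := by
  classical
  have hcol : ∀ π : OverlapPair H part m, π.1.1.1 ≠ π.1.2.1 := fun π h =>
    π.2.1.2 (edge_eq_of_part_eq hH ht hQc hQ h π.2.1.1)
  have hcard : ∀ a, (unionEdges H a).card = q := fun a => (hH a.1).1 _ a.2.2
  have hcu : ∀ π : OverlapPair H part m, (unionEdges H π.1.1 \ unionEdges H π.1.2).card = m :=
    fun π => π.2.2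
  have hcw : ∀ π : OverlapPair H part m, (unionEdges H π.1.2 \ unionEdges H π.1.1).card = m :=
    fun π => (Finset.card_sdiff_comm ((hcard _).trans (hcard _).symm)).trans (hcu π)
  rcases isEmpty_or_nonempty (OverlapPair H part m) with hemp | ⟨⟨π₀⟩⟩
  · simp only [Finset.univ_eq_empty, Finset.sum_empty, Finset.expect_const_zero]
    positivity
  have hmq : m + t ≤ q := by
    rw [← hcu π₀]
    exact card_sdiff_add_le hH hQc hQ π₀.2.1.1
  rcases Nat.eq_zero_or_pos m with rfl | hm
  -- For `m = 0` the two hyperedges are parallel: the monomial is 1 and the signs of two distinct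
  -- colours have mean zero.
  · have hzero : (𝔼 b : Fin k → ℤˣ, ∑ π : OverlapPair H part 0,
      ((b π.1.1.1 : ℤ) : ℝ) * ((b π.1.2.1 : ℤ) : ℝ) *
        ((∏ v ∈ unionEdges H π.1.1, ((x b v : ℤ) : ℝ)) *
          ∏ v ∈ unionEdges H π.1.2, ((x b v : ℤ) : ℝ))) = 0 := by
      rw [Finset.expect_sum_comm]
      refine Finset.sum_eq_zero fun π _ => ?_
      rw [← expect_sign_mul (hcol π)]
      refine Finset.expect_congr rfl fun b _ => ?_
      rw [prod_mul_prod_eq_sdiff fun v => units_cast_mul_self _, Finset.card_eq_zero.1 (hcu π),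
        Finset.card_eq_zero.1 (hcw π)]
      simp
    rw [hzero]
    positivity
  have hn : 2 ≤ n := by
    obtain ⟨v, hv⟩ := Finset.card_pos.1 (by rw [hcu]; exact hm :
      0 < (unionEdges H π₀.1.1 \ unionEdges H π₀.1.2).card)
    obtain ⟨v', hv'⟩ := Finset.card_pos.1 (by rw [hcw]; exact hm :
      0 < (unionEdges H π₀.1.2 \ unionEdges H π₀.1.1).card)
    have hne : v ≠ v' := by
      rintro rfl
      exact (Finset.mem_sdiff.1 hv).2 (Finset.mem_sdiff.1 hv').1
    have := v.isLt
    have := v'.isLt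
    have := Fin.val_ne_of_ne hne
    omega
  set u : OverlapPair H part m → Fin m → Fin n := fun π => Finset.orderEmbOfFin _ (hcu π) with hu
  set w : OverlapPair H part m → Fin m → Fin n := fun π => Finset.orderEmbOfFin _ (hcw π) with hw
  have hum : ∀ π j, u π j ∈ unionEdges H π.1.1 \ unionEdges H π.1.2 :=
    fun π j => Finset.orderEmbOfFin_mem _ (hcu π) j
  have hwm : ∀ π j, w π j ∈ unionEdges H π.1.2 \ unionEdges H π.1.1 :=
    fun π j => Finset.orderEmbOfFin_mem _ (hcw π) j
  have huw : ∀ π j j', u π j ≠ w π j' := fun π j j' h =>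
    (Finset.mem_sdiff.1 (hum π j)).2 (h ▸ (Finset.mem_sdiff.1 (hwm π j')).1)
  have hui : ∀ π, Function.Injective (u π) := fun π => (Finset.orderEmbOfFin _ (hcu π)).injective
  have hwi : ∀ π, Function.Injective (w π) := fun π => (Finset.orderEmbOfFin _ (hcw π)).injective
  have hhalf : (Finset.univ.filter fun j : Fin m => j.val < (m + 1) / 2).card = (m + 1) / 2 := by
    rw [Fin.card_filter_val_lt]
    omega
  have hhalf' : (Finset.univ.filter fun j : Fin m => ¬ j.val < (m + 1) / 2).card ≤
      (m + 1) / 2 := by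
    have := Finset.card_filter_add_card_filter_not (s := (Finset.univ : Finset (Fin m)))
      fun j : Fin m => j.val < (m + 1) / 2
    rw [hhalf, Finset.card_univ, Fintype.card_fin] at this
    omega
  -- The halves are crossed: each takes at most `(m + 1) / 2` letters from either difference, which
  -- keeps the codegrees within the range of the good-index inequalities.
  set z : OverlapPair H part m → Fin m → Fin n := fun π j =>
    if j.val < (m + 1) / 2 then u π j else w π j with hz
  set z' : OverlapPair H part m → Fin m → Fin n := fun π j =>
    if j.val < (m + 1) / 2 then w π j else u π j with hz'
  have hzi : ∀ π, Function.Injective (z π) := by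
    intro π j j' h
    simp only [hz] at h
    split_ifs at h
    · exact hui π h
    · exact absurd h (huw π _ _)
    · exact absurd h.symm (huw π _ _)
    · exact hwi π h
  have hzi' : ∀ π, Function.Injective (z' π) := by
    intro π j j' h
    simp only [hz'] at h
    split_ifs at h
    · exact hwi π h
    · exact absurd h.symm (huw π _ _)
    · exact absurd h (huw π _ _)
    · exact hui π h
  have hcount := card_pairs_le_rpow z (fun j => j.val < (m + 1) / 2) hH ht htq hq (by omega) hQc hQ
    hsize hg hdt (by omega) hhalf.le hhalf' hzi
    (fun π j hj => by simp only [hz, if_pos hj]; exact (Finset.mem_sdiff.1 (hum π j)).1)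
    (fun π j hj => by simp only [hz, if_neg hj]; exact hwm π j)
  have hcount' := card_pairs_le_rpow z' (fun j => ¬ j.val < (m + 1) / 2) hH ht htq hq (by omega)
    hQc hQ hsize hg hdt (by omega) hhalf' (by simpa only [not_not] using hhalf.le) hzi'
    (fun π j hj => by simp only [hz', if_neg hj]; exact (Finset.mem_sdiff.1 (hum π j)).1)
    (fun π j hj => by simp only [hz', if_pos (not_not.1 hj)]; exact hwm π j)
  refine le_trans (le_of_eq ?_) (expect_kikuchi_pair_le hn (by omega) (by omega)
    (fun π : OverlapPair H part m => π.1.1.1) (fun π => π.1.2.1) hcol z z'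
    (by exact_mod_cast hdt) hcount hcount' x)
  refine Finset.expect_congr rfl fun b _ => Finset.sum_congr rfl fun π _ => ?_
  rw [prod_mul_prod_eq_sdiff fun v => units_cast_mul_self _, prod_eq_prod_orderEmbOfFin _ (hcu π),
    prod_eq_prod_orderEmbOfFin _ (hcw π), ← Finset.prod_mul_distrib]
  congr 1
  refine Finset.prod_congr rfl fun j _ => ?_
  simp only [hz, hz', hu, hw]
  split_ifs
  · rfl
  · rw [mul_comm]
end Pairs

/-! ### Cauchy–Schwarz over the parts, and odd uniformity. -/

section CauchySchwarz
variable {n k q t p : ℕ} {H : Fin k → Finset (Finset (Fin n))}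
  {part : (Σ i : Fin k, {C : Finset (Fin n) // C ∈ H i}) → Fin p}
  {Q : Fin p → Finset (Fin n)}

/-- The Cauchy–Schwarz inequality over the parts of a partition. -/
lemma sq_sum_le_of_partition {E : Type*} [Fintype E] [DecidableEq E] (part : E → Fin p)
    (f : E → ℝ) (hf : ∀ a, f a * f a = 1) :
    (∑ a, f a) ^ 2 ≤ p * (Fintype.card E +
      ∑ π : E × E with part π.1 = part π.2 ∧ π.1 ≠ π.2, f π.1 * f π.2) := by
  rw [← Finset.sum_fiberwise Finset.univ part]
  refine sq_sum_le_card_mul_sum_sq.trans_eq ?_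
  rw [Finset.card_univ, Fintype.card_fin]
  congr 1
  have h1 : ∑ θ, (∑ a with part a = θ, f a) ^ 2 =
      ∑ π : E × E with part π.1 = part π.2, f π.1 * f π.2 := by
    simp_rw [sq, Finset.sum_mul_sum, Finset.sum_filter, Fintype.sum_prod_type]
    rw [Finset.sum_comm]
    refine Finset.sum_congr rfl fun a _ => ?_
    simp [eq_comm]
  have h2 : ∑ π : E × E with part π.1 = part π.2 ∧ π.1 = π.2, f π.1 * f π.2 =
      Fintype.card E := by
    simp_rw [Finset.sum_filter, Fintype.sum_prod_type]
    have : ∀ a : E, ∑ a', (if part a = part a' ∧ a = a' then f a * f a' else 0) = 1 := by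
      intro a
      rw [Finset.sum_eq_single a]
      · simp [hf]
      · intro a' _ h
        rw [if_neg fun h' => h h'.2.symm]
      · simp
    simp [this]
  rw [h1, ← h2, ← Finset.sum_filter_add_sum_filter_not _ fun π : E × E => π.1 = π.2,
    Finset.filter_filter, Finset.filter_filter]

lemma expect_xorVal_sq_le_of_odd (hH : ∀ i, IsUniformMatching q (H i)) (ht : 1 ≤ t) (htq : t ≤ q)
    (hq : Odd q)
    (hQc : ∀ θ, (Q θ).card = t) (hQ : ∀ a, Q (part a) ⊆ unionEdges H a)
    (hsize : ∀ θ, (Finset.univ.filter fun a => part a = θ).card ≤ maxCodegree (unionEdges H) t)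
    (hg : IsGoodIndex n q (maxCodegree (unionEdges H)) t)
    (hdt : 0 < maxCodegree (unionEdges H) t) :
    (𝔼 b : Fin k → ℤˣ, xorVal H b ^ 2) ≤ p * (numEdges H + q *
      (4 * (maxCodegree (unionEdges H) t * n * √(k * levelParam n q) *
        √(kikuchiConst q * Real.log n)))) := by
  classical
  obtain ⟨x, hx⟩ := exists_xorVal_eq H
  have hpt : ∀ b : Fin k → ℤˣ, xorVal H b ^ 2 ≤ p * (numEdges H + ∑ m ∈ Finset.range q,
      ∑ π : OverlapPair H part m, ((b π.1.1.1 : ℤ) : ℝ) * ((b π.1.2.1 : ℤ) : ℝ) *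
        ((∏ v ∈ unionEdges H π.1.1, ((x b v : ℤ) : ℝ)) *
          ∏ v ∈ unionEdges H π.1.2, ((x b v : ℤ) : ℝ))) := by
    intro b
    rw [hx, xorPoly_eq_sum, ← card_unionEdges]
    refine (sq_sum_le_of_partition part _ fun a => ?_).trans_eq ?_
    · rw [mul_mul_mul_comm, units_cast_mul_self, one_mul, ← Finset.prod_mul_distrib]
      exact Finset.prod_eq_one fun v _ => units_cast_mul_self _
    congr 2
    -- Only `m < q` occurs, since two hyperedges of a part share at least `t ≥ 1` vertices.
    rw [← Finset.sum_fiberwise_of_maps_to (t := Finset.range q)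
      (g := fun π => (unionEdges H π.1 \ unionEdges H π.2).card)]
    · refine Finset.sum_congr rfl fun m _ => ?_
      rw [Finset.filter_filter]
      refine (Finset.sum_subtype _ (p := fun π => (part π.1 = part π.2 ∧ π.1 ≠ π.2) ∧
        (unionEdges H π.1 \ unionEdges H π.2).card = m)
        (F := inferInstance) (by simp) _).trans ?_
      refine Finset.sum_congr rfl fun π _ => ?_
      ring
    · intro π hπ
      have := card_sdiff_add_le hH hQc hQ (Finset.mem_filter.1 hπ).2.1
      rw [Finset.mem_range]
      omega
  refine (Finset.expect_le_expect fun b _ => hpt b).trans ?_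
  rw [← Finset.mul_expect, Finset.expect_add_distrib, Fintype.expect_const,
    Finset.expect_sum_comm]
  gcongr
  refine (Finset.sum_le_sum fun m _ =>
    expect_pairs_le hH ht htq hq hQc hQ hsize hg hdt m x).trans_eq ?_
  simp
end CauchySchwarz

/-! ### The two parities combined. -/

theorem lemma4p3 (q : ℕ) :
    ∃ A : ℝ, 0 < A ∧
      ∀ (n k t : ℕ) (H : Fin k → Finset (Finset (Fin n))),
        (∀ i, IsUniformMatching q (H i)) →
        IsApproxStronglyRegular q t (unionEdges H) →
        (maxCodegree (unionEdges H) 1 : ℝ) ≤ (k : ℝ) →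
        levelParam n q ≤ (maxCodegree (unionEdges H) 1 : ℝ) →
        (𝔼 b : Fin k → ℤˣ, xorVal H b ^ 2) ≤
          2 * (numEdges H : ℝ) ^ 2 / (maxCodegree (unionEdges H) t : ℝ) +
            (numEdges H : ℝ) * (n : ℝ) * √((k : ℝ) * levelParam n q) * √(A * Real.log n) := by
  have hK := kikuchiConst_pos q
  -- The factor `8 (q + 1)` covers 2 from `p d_t ≤ 2|H|`, 4 from decoupling and the `q` values of
  -- `m`.
  refine ⟨(8 * (q + 1)) ^ 2 * kikuchiConst q, by positivity, ?_⟩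
  intro n k t H hH hR _ _
  have hsqrt : √((8 * ((q : ℝ) + 1)) ^ 2 * kikuchiConst q * Real.log n) =
      8 * (q + 1) * √(kikuchiConst q * Real.log n) := by
    rw [mul_assoc, Real.sqrt_mul (by positivity), Real.sqrt_sq (by positivity)]
  rw [hsqrt]
  rcases isEmpty_or_nonempty (Σ i : Fin k, {C : Finset (Fin n) // C ∈ H i}) with hE | ⟨⟨a⟩⟩
  · have hzero : ∀ b, xorVal H b = 0 := by
      intro b
      obtain ⟨x, hx⟩ := exists_xorVal_eq H
      rw [hx, xorPoly_eq_sum, Finset.univ_eq_empty, Finset.sum_empty]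
    simp only [hzero, ne_eq, OfNat.ofNat_ne_zero, not_false_eq_true, zero_pow,
      Finset.expect_const_zero]
    positivity
  have hcard : (unionEdges H a).card = q := hR.uniform a
  have hdt : 0 < maxCodegree (unionEdges H) t :=
    one_le_maxCodegree _ a (by rw [hcard]; exact hR.le_q)
  have hdt' : (0 : ℝ) < maxCodegree (unionEdges H) t := by exact_mod_cast hdt
  have ht := hR.one_le
  have htq := hR.le_q
  set X : ℝ := √(k * levelParam n q) with hX
  set Y : ℝ := √(kikuchiConst q * Real.log n) with hY
  rcases Nat.even_or_odd q with ⟨m, rfl⟩ | hodd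
  · have hn : 2 ≤ n := by
      have : (unionEdges H a).card ≤ n := by simpa using Finset.card_le_univ (unionEdges H a)
      omega
    refine (expect_xorVal_sq_le_of_even hn (by omega) hH).trans ?_
    have h1 : 0 ≤ 2 * (numEdges H : ℝ) ^ 2 / (maxCodegree (unionEdges H) t : ℝ) := by positivity
    have h2 : 0 ≤ (numEdges H : ℝ) * n * X * Y := by positivity
    have h3 : (1 : ℝ) ≤ 8 * (((m + m : ℕ) : ℝ) + 1) := by
      have : (0 : ℝ) ≤ ((m + m : ℕ) : ℝ) := Nat.cast_nonneg _
      linarith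
    calc (numEdges H : ℝ) * (n * X * Y) = 1 * ((numEdges H : ℝ) * n * X * Y) := by ring
      _ ≤ 8 * (((m + m : ℕ) : ℝ) + 1) * ((numEdges H : ℝ) * n * X * Y) := by gcongr
      _ ≤ _ := by linarith
  · obtain ⟨p, part, Q, hQc, hQ, hlow, hsize⟩ := hR.exists_partition
    refine (expect_xorVal_sq_le_of_odd hH ht htq hodd hQc hQ hsize hR.good hdt).trans ?_
    -- The parts are disjoint and each has at least `d_t / 2` hyperedges.
    have hp : (p : ℝ) * maxCodegree (unionEdges H) t ≤ 2 * numEdges H := by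
      have h : ∑ _θ : Fin p, (maxCodegree (unionEdges H) t : ℝ) / 2 ≤ numEdges H := by
        refine (Finset.sum_le_sum fun θ _ => hlow θ).trans_eq ?_
        rw [← card_unionEdges, ← Finset.card_univ,
          Finset.card_eq_sum_card_fiberwise (f := part) (t := Finset.univ) (by simp)]
        push_cast
        rfl
      rw [Finset.sum_const, Finset.card_univ, Fintype.card_fin, nsmul_eq_mul] at h
      linarith
    have h1 : (p : ℝ) * numEdges H ≤
        2 * (numEdges H : ℝ) ^ 2 / (maxCodegree (unionEdges H) t : ℝ) := by
      rw [le_div_iff₀ hdt']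
      nlinarith [(Nat.cast_nonneg (numEdges H) : (0 : ℝ) ≤ numEdges H)]
    have h2 : (p : ℝ) * (q * (4 * (maxCodegree (unionEdges H) t * n * X * Y))) ≤
        numEdges H * n * X * (8 * (q + 1) * Y) := by
      calc _ = (p * maxCodegree (unionEdges H) t : ℝ) * (4 * q * (n * X * Y)) := by ring
        _ ≤ (2 * numEdges H) * (4 * (q + 1) * (n * X * Y)) := by
            gcongr
            linarith
        _ = _ := by ring
    rw [mul_add]
    exact add_le_add h1 h2
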